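/- Let $n\ge 0$. The partition monoid $\mathcal{P}_n$ consists of all partitions of $[n]\cup[n]'$, where $[n]=\{1,\dots,n\}$ and $[n]'=\{1',\dots,n'\}$. The product $ab$ is formed by drawing $a$ above $b$, identifying the lower row of $a$ with the upper row of $b$, and letting two points of the outer rows be in the same block of $ab$ iff they are connected in the resulting diagram. The partial Brauer monoid $\mathcal{PB}_n$ (the Brauer monoid $\mathcal{B}_n$) is the submonoid of all partitions whose blocks have size at most $2$ (exactly $2$). For an element $a$ of a finite monoid $S$, let $a^{\omega}$ be the identity element of the subgroup of $S$ that contains some positive power of $a$, and let $a^{\omega+1}=a^{\omega}a$. Elements $a,b\in S$ are *trace conjugate in $S$*, written $a\sim_{tr}b$, if there are $g,h\in S$ with $ghg=g$, $hgh=h$, $gh=a^{\omega}$, $hg=b^{\omega}$ and $ha^{\omega+1}g=b^{\omega+1}$. A block of $a\in\mathcal{P}_n$ is transversal if it meets both $[n]$ and $[n]'$. Let $a\in\mathcal{P}_n$ be a group element (an element of some subgroup of $\mathcal{P}_n$). Let $\ker(a)$ be the equivalence relation that $a$ induces on $[n]$, and $\mathrm{coker}^{\wedge}(a)$ the one that it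 induces on $[n]'$, transferred to $[n]$. Let $P_1,\dots,P_m$ be the distinct blocks of the join $\ker(a)\vee\mathrm{coker}^{\wedge}(a)$ that meet a transversal block of $a$. Each $P_i$ contains exactly one block $A_i$ of $\ker(a)$ that is the upper part of a transversal block, and exactly one block $B_i$ of $\mathrm{coker}^{\wedge}(a)$ such that $B_i'$ is the lower part of a transversal block. The rule $i\tau_a=j\iff A_i\cup B_j'$ is a transversal block of $a$ defines a permutation $\tau_a$ of $\{1,\dots,m\}$. The *cycle type* of $a$ is the sequence $(k_1,\dots,k_m)$, where $k_i$ is the number of cycles of length $i$ of $\tau_a$ (fixed points included); for $m=0$ it is $(0)$. **Theorem.** Let $S$ be one of the monoids $\mathcal{P}_n$, $\mathcal{PB}_n$, $\mathcal{B}_n$, and let $a,b\in S$. Then $a\sim_{tr}b$ in $S$ if and only if $a^{\omega+1}$ and $b^{\omega+1}$ have the same cycle type. -/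

import Mathlib

/-! ### Partition monoids -/

/-- An element of the partition monoid of degree `n`: a partition (equivalence relation) of the
disjoint union of `{1, …, n}` (upper points, `Sum.inl`) and its copy `{1', …, n'}` (lower points,
`Sum.inr`). -/
@[ext]
structure PartitionMonoid (n : ℕ) where
  /-- the underlying equivalence relation -/
  rel : Setoid (Fin n ⊕ Fin n)

namespace PartitionMonoid

variable {n : ℕ}

/-- The three rows of points used to multiply: top (`inl x`), middle (`inr (inl x)`) and bottom
(`inr (inr x)`). -/
abbrev Rows (n : ℕ) : Type := Fin n ⊕ (Fin n ⊕ Fin n)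

/-- Place the upper and lower points on the top and middle row. -/
def upperRows : Fin n ⊕ Fin n → Rows n := Sum.map id Sum.inl

/-- Place the upper and lower points on the middle and bottom row. -/
def lowerRows : Fin n ⊕ Fin n → Rows n := Sum.inr

/-- Place the upper and lower points on the top and bottom row. -/
def outerRows : Fin n ⊕ Fin n → Rows n := Sum.map id Sum.inr

/-- The edges of the diagram obtained by drawing `a` over `b` and gluing the two middle rows. -/
inductive StarEdge (a b : PartitionMonoid n) : Rows n → Rows n → Prop
  | upper {p q : Fin n ⊕ Fin n} : a.rel p q → StarEdge a b (upperRows p) (upperRows q)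
  | lower {p q : Fin n ⊕ Fin n} : b.rel p q → StarEdge a b (lowerRows p) (lowerRows q)

/-- The connected components of the diagram obtained by drawing `a` over `b`. -/
def star (a b : PartitionMonoid n) : Setoid (Rows n) := Relation.EqvGen.setoid (StarEdge a b)

/-- The product `a * b`: two points of the top and bottom row are in the same block
if and only if they are connected in the diagram of `a` over `b`. -/
instance : Mul (PartitionMonoid n) := ⟨fun a b => ⟨(star a b).comap outerRows⟩⟩

/-- The identity partition, whose blocks are the sets `{x, x'}`. -/
instance : One (PartitionMonoid n) := ⟨⟨Setoid.ker (Sum.elim id id)⟩⟩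

theorem mul_rel {a b : PartitionMonoid n} {p q : Fin n ⊕ Fin n} :
    (a * b).rel p q ↔ star a b (outerRows p) (outerRows q) := Iff.rfl

theorem one_rel {p q : Fin n ⊕ Fin n} :
    (1 : PartitionMonoid n).rel p q ↔ Sum.elim id id p = Sum.elim id id q := Iff.rfl

/-- `A ∪ B'` is a union of blocks of `a`. -/
def Inv (a : PartitionMonoid n) (A B : Fin n → Prop) : Prop :=
  ∀ p q, a.rel p q → Sum.elim A B p → Sum.elim A B q

theorem ext_inv {a b : PartitionMonoid n} (h : ∀ A B, Inv a A B ↔ Inv b A B) : a = b := by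
  have key : ∀ c d : PartitionMonoid n, (∀ A B, Inv d A B → Inv c A B) →
      ∀ p q, c.rel p q → d.rel p q := by
    intro c d hcd p q hpq
    have hd : Inv d (fun x => d.rel p (Sum.inl x)) (fun x => d.rel p (Sum.inr x)) := by
      rintro (u | u) (v | v) huv hu <;> exact d.rel.trans' hu huv
    have := hcd _ _ hd p q hpq
    rcases p with p | p <;> rcases q with q | q <;> exact this (d.rel.refl' _)
  ext p q
  exact ⟨key a b (fun A B => (h A B).2) p q, key b a (fun A B => (h A B).1) p q⟩

theorem star_invariant {a b : PartitionMonoid n} {C : Rows n → Prop}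
    (hC : ∀ u v, StarEdge a b u v → C u → C v) {u v : Rows n} (h : star a b u v) :
    C u ↔ C v := by
  have h' : Relation.EqvGen (StarEdge a b) u v := h
  clear h
  induction h' with
  | rel x y hxy =>
    refine ⟨hC _ _ hxy, hC _ _ ?_⟩
    cases hxy with
    | upper h => exact .upper (a.rel.symm' h)
    | lower h => exact .lower (b.rel.symm' h)
  | refl x => exact Iff.rfl
  | symm x y _ ih => exact ih.symm
  | trans x y z _ _ ih1 ih2 => exact ih1.trans ih2

theorem inv_mul {a b : PartitionMonoid n} {A B : Fin n → Prop} :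
    Inv (a * b) A B ↔ ∃ M, Inv a A M ∧ Inv b M B := by
  constructor
  · intro h
    let C : Rows n → Prop := fun v => ∃ p, Sum.elim A B p ∧ star a b (outerRows p) v
    have hC : ∀ u v, StarEdge a b u v → C u → C v := by
      rintro u v huv ⟨p, hp, hpu⟩
      exact ⟨p, hp, (star a b).trans' hpu (Relation.EqvGen.rel _ _ huv)⟩
    have hout : ∀ p, C (outerRows p) ↔ Sum.elim A B p := by
      intro p
      constructor
      · rintro ⟨q, hq, hqp⟩
        exact h q p hqp hq
      · intro hp
        exact ⟨p, hp, (star a b).refl' _⟩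
    refine ⟨fun x => C (Sum.inr (Sum.inl x)), ?_, ?_⟩
    · have hup : ∀ p, Sum.elim A (fun x => C (Sum.inr (Sum.inl x))) p ↔ C (upperRows p) := by
        rintro (x | x)
        · exact (hout (Sum.inl x)).symm
        · exact Iff.rfl
      intro p q hpq hp
      rw [hup] at hp ⊢
      exact hC _ _ (.upper hpq) hp
    · have hlo : ∀ p, Sum.elim (fun x => C (Sum.inr (Sum.inl x))) B p ↔ C (lowerRows p) := by
        rintro (x | x)
        · exact Iff.rfl
        · exact (hout (Sum.inr x)).symm
      intro p q hpq hp
      rw [hlo] at hp ⊢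
      exact hC _ _ (.lower hpq) hp
  · rintro ⟨M, ha, hb⟩ p q hpq hp
    let C : Rows n → Prop := Sum.elim A (Sum.elim M B)
    have hC : ∀ u v, StarEdge a b u v → C u → C v := by
      intro u v huv
      cases huv with
      | @upper p q h =>
        have := ha p q h
        rcases p with p | p <;> rcases q with q | q <;> exact this
      | @lower p q h => exact hb p q h
    have := (star_invariant hC hpq).1
    rcases p with p | p <;> rcases q with q | q <;> exact this hp

theorem inv_one {A B : Fin n → Prop} : Inv (1 : PartitionMonoid n) A B ↔ A = B := by
  constructor
  · intro h
    funext x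
    exact propext ⟨h (Sum.inl x) (Sum.inr x) rfl, h (Sum.inr x) (Sum.inl x) rfl⟩
  · rintro rfl (p | p) (q | q) hpq hp <;> (cases hpq; exact hp)

instance : Monoid (PartitionMonoid n) where
  mul_assoc a b c := ext_inv fun A B => by
    simp only [inv_mul]
    constructor
    · rintro ⟨M, ⟨N, h1, h2⟩, h3⟩
      exact ⟨N, h1, M, h2, h3⟩
    · rintro ⟨N, h1, M, h2, h3⟩
      exact ⟨M, ⟨N, h1, h2⟩, h3⟩
  one_mul a := ext_inv fun A B => by simp [inv_mul, inv_one]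
  mul_one a := ext_inv fun A B => by simp [inv_mul, inv_one]

instance : Finite (PartitionMonoid n) :=
  Finite.of_injective (fun a : PartitionMonoid n => fun p q => a.rel p q) fun a b h => by
    ext p q
    exact iff_of_eq (congrFun (congrFun h p) q)

/-! ### Blocks of a partition -/

/-- The blocks of `a`. -/
def blocks (a : PartitionMonoid n) : Set (Set (Fin n ⊕ Fin n)) := a.rel.classes

/-- A transversal block of `a`: one that contains both upper and lower points. -/
def IsTransversal (a : PartitionMonoid n) (s : Set (Fin n ⊕ Fin n)) : Prop :=
  s ∈ a.blocks ∧ (∃ x, Sum.inl x ∈ s) ∧ ∃ y, Sum.inr y ∈ s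

/-- `ker a`, as an equivalence relation on `{1, …, n}`. -/
def ker (a : PartitionMonoid n) : Setoid (Fin n) := a.rel.comap Sum.inl

/-- `coker a`, transferred from `{1', …, n'}` to `{1, …, n}`. -/
def coker (a : PartitionMonoid n) : Setoid (Fin n) := a.rel.comap Sum.inr

/-- The points `x` that lie in a transversal block. -/
def dom (a : PartitionMonoid n) : Set (Fin n) := {x | ∃ s, a.IsTransversal s ∧ Sum.inl x ∈ s}

/-- The points `x` such that `x'` lies in a transversal block. -/
def codom (a : PartitionMonoid n) : Set (Fin n) := {x | ∃ s, a.IsTransversal s ∧ Sum.inr x ∈ s}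

/-- The blocks of `ker a` that are contained in the domain of `a`. -/
def kerT (a : PartitionMonoid n) : Set (Set (Fin n)) := {A | A ∈ a.ker.classes ∧ A ⊆ a.dom}

/-- The blocks of `coker a` that are contained in the codomain of `a`. -/
def cokerT (a : PartitionMonoid n) : Set (Set (Fin n)) := {B | B ∈ a.coker.classes ∧ B ⊆ a.codom}

/-- The blocks `P` of the join of `ker a` and `coker a` that intersect a transversal block
of `a`. -/
def activeBlocks (a : PartitionMonoid n) : Set (Set (Fin n)) :=
  {P | P ∈ (a.ker ⊔ a.coker).classes ∧ ∃ s, a.IsTransversal s ∧ ((Sum.inl '' P) ∩ s).Nonempty}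

/-! ### Brauer monoids -/

/-- The edges between two different points in the diagram of `a` over `b`: those of `a` for
`t = false`, those of `b` for `t = true`. -/
def PathEdge (a b : PartitionMonoid n) (t : Bool) (u v : Rows n) : Prop :=
  ∃ p q, p ≠ q ∧ cond t (b.rel p q) (a.rel p q) ∧
    u = cond t (lowerRows p) (upperRows p) ∧ v = cond t (lowerRows q) (upperRows q)

theorem upperRows_injective : Function.Injective (upperRows (n := n)) :=
  Function.Injective.sumMap Function.injective_id Sum.inl_injective

theorem lowerRows_injective : Function.Injective (lowerRows (n := n)) := Sum.inr_injective

theorem outerRows_injective : Function.Injective (outerRows (n := n)) :=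
  Function.Injective.sumMap Function.injective_id Sum.inr_injective

/-- In a graph whose edges have two colours, each colour class being a matching, the component of
a point `p` without an edge of colour `t₀` is a path starting in `p`. -/
theorem exists_path {V : Type*} [Finite V] (R : Bool → V → V → Prop)
    (hsymm : ∀ t u v, R t u v → R t v u) (hirr : ∀ t u, ¬ R t u u)
    (hfun : ∀ t u v w, R t u v → R t u w → v = w)
    (p : V) (t₀ : Bool) (hp : ∀ v, ¬ R t₀ p v) :
    ∃ (S : Set V) (v : V) (t : Bool), p ∈ S ∧ (∀ s, ∀ u ∈ S, ∀ w, R s u w → w ∈ S) ∧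
      (∀ u ∈ S, u ≠ p → u ≠ v → ∀ s, ∃ w, R s u w) ∧ (∀ w, ¬ R t v w) ∧
      Relation.EqvGen (fun u w => ∃ s, R s u w) p v ∧ (v = p → t = !t₀) := by
  have main : ∀ (k : ℕ) (S : Set V) (v : V) (t : Bool), Sᶜ.ncard = k → p ∈ S → v ∈ S →
      (∀ s, ∀ u ∈ S, ∀ w, R s u w → w ∈ S ∨ (u = v ∧ s = t)) →
      (∀ u ∈ S, u ≠ p → u ≠ v → ∀ s, ∃ w, R s u w) →
      (∀ u ∈ S, ¬ R t u v) →
      (v = p → t = !t₀) → (v ≠ p → ∃ w, R (!t) v w) →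
      Relation.EqvGen (fun u w => ∃ s, R s u w) p v →
      ∃ (S : Set V) (v : V) (t : Bool), p ∈ S ∧ (∀ s, ∀ u ∈ S, ∀ w, R s u w → w ∈ S) ∧
        (∀ u ∈ S, u ≠ p → u ≠ v → ∀ s, ∃ w, R s u w) ∧ (∀ w, ¬ R t v w) ∧
        Relation.EqvGen (fun u w => ∃ s, R s u w) p v ∧ (v = p → t = !t₀) := by
    intro k
    induction k using Nat.strong_induction_on with
    | _ k ih =>
      intro S v t hk hpS hvS hcl hdeg hnew hvp hvne hconn
      by_cases hex : ∃ w, R t v w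
      · obtain ⟨w, hw⟩ := hex
        have hwS : w ∉ S := fun h => hnew w h (hsymm _ _ _ hw)
        have hwv : w ≠ v := fun h => hwS (h ▸ hvS)
        have hwp : w ≠ p := fun h => hwS (h ▸ hpS)
        refine ih _ ?_ (insert w S) w (!t) rfl (Set.mem_insert_of_mem _ hpS)
          (Set.mem_insert _ _) ?_ ?_ ?_ (fun h => absurd h hwp) ?_ ?_
        · rw [← hk]
          refine Set.ncard_lt_ncard ?_ (Set.toFinite _)
          refine ⟨fun x hx hxS => hx (Set.mem_insert_of_mem _ hxS), fun h => ?_⟩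
          exact h hwS (Set.mem_insert _ _)
        · intro s u hu z hz
          rcases hu with rfl | hu
          · by_cases hs : s = t
            · subst hs
              left
              right
              rw [hfun _ _ _ _ hz (hsymm _ _ _ hw)]
              exact hvS
            · exact Or.inr ⟨rfl, Bool.eq_not.2 hs⟩
          · rcases hcl s u hu z hz with h | ⟨rfl, rfl⟩
            · exact Or.inl (Set.mem_insert_of_mem _ h)
            · left
              left
              exact hfun _ _ _ _ hz hw
        · intro u hu hup huw s
          rcases hu with rfl | hu
          · exact absurd rfl huw
          · by_cases huv : u = v
            · subst huv
              by_cases hs : s = t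
              · exact hs ▸ ⟨w, hw⟩
              · have : s = !t := Bool.eq_not.2 hs
                exact this ▸ hvne hup
            · exact hdeg u hu hup huv s
        · intro u hu hR
          rcases hu with rfl | hu
          · exact hirr _ _ hR
          · rcases hcl _ u hu w hR with h | ⟨_, h⟩
            · exact hwS h
            · cases t <;> simp at h
        · intro _
          exact ⟨v, by simpa using hsymm _ _ _ hw⟩
        · exact hconn.trans _ _ _ (.rel _ _ ⟨t, hw⟩)
      · push Not at hex
        refine ⟨S, v, t, hpS, ?_, hdeg, hex, hconn, hvp⟩
        intro s u hu w hR
        rcases hcl s u hu w hR with h | ⟨rfl, rfl⟩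
        · exact h
        · exact absurd hR (hex w)
  refine main _ {p} p (!t₀) rfl rfl rfl ?_ ?_ ?_ (fun _ => rfl) (fun h => absurd rfl h) (.refl _)
  · rintro s u rfl w hR
    right
    refine ⟨rfl, ?_⟩
    by_cases hs : s = t₀
    · exact absurd (hs ▸ hR) (hp w)
    · exact Bool.eq_not.2 hs
  · rintro u rfl h
    exact absurd rfl h
  · rintro u rfl hR
    exact hirr _ _ hR

theorem eq_of_block_le_two {a : PartitionMonoid n} (ha : ∀ s ∈ a.blocks, s.ncard ≤ 2)
    {p q r : Fin n ⊕ Fin n} (hq : p ≠ q) (hr : p ≠ r) (h1 : a.rel p q) (h2 : a.rel p r) :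
    q = r := by
  by_contra hqr
  have hs := ha _ (Setoid.mem_classes a.rel p)
  have h3 : ({p, q, r} : Set (Fin n ⊕ Fin n)).ncard = 3 :=
    Set.ncard_eq_three.2 ⟨p, q, r, hq, hr, hqr, rfl⟩
  have h4 : ({p, q, r} : Set (Fin n ⊕ Fin n)) ⊆ {x | a.rel x p} := by
    rintro x (rfl | rfl | rfl)
    · exact a.rel.refl' _
    · exact a.rel.symm' h1
    · exact a.rel.symm' h2
  have := Set.ncard_le_ncard h4 (Set.toFinite _)
  omega

/-- The component of an outer point `p` in the diagram of two partitions with blocks of size at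
most two. -/
theorem exists_component {a b : PartitionMonoid n} (ha : ∀ s ∈ a.blocks, s.ncard ≤ 2)
    (hb : ∀ s ∈ b.blocks, s.ncard ≤ 2) (p : Fin n ⊕ Fin n) :
    ∃ v : Rows n, (∀ q, (a * b).rel p q → q = p ∨ outerRows q = v) ∧
      star a b (outerRows p) v ∧ ∃ t, (∀ w, ¬ PathEdge a b t v w) ∧
        (v = outerRows p → ∀ w, ¬ PathEdge a b false v w ∧ ¬ PathEdge a b true v w) := by
  have hedge : ∀ t u v, PathEdge a b t u v → StarEdge a b u v := by
    rintro (_ | _) u v ⟨p, q, _, h, rfl, rfl⟩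
    · exact .upper h
    · exact .lower h
  have hmiss : ∀ q : Fin n ⊕ Fin n, ∃ t, ∀ w, ¬ PathEdge a b t (outerRows q) w := by
    rintro (x | x)
    · refine ⟨true, ?_⟩
      rintro w ⟨p, q, _, _, h, _⟩
      simp [outerRows, lowerRows] at h
    · refine ⟨false, ?_⟩
      rintro w ⟨p | p, q, _, _, h, _⟩ <;> simp [outerRows, upperRows] at h
  obtain ⟨t₀, ht₀⟩ := hmiss p
  obtain ⟨S, v, t, hpS, hcl, hdeg, hv, hconn, hvp⟩ := exists_path (PathEdge a b)
    (by
      rintro (_ | _) u v ⟨p, q, hpq, h, rfl, rfl⟩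
      · exact ⟨q, p, hpq.symm, a.rel.symm' h, rfl, rfl⟩
      · exact ⟨q, p, hpq.symm, b.rel.symm' h, rfl, rfl⟩)
    (by
      rintro (_ | _) u ⟨p, q, hpq, h, h1, h2⟩
      · exact hpq (upperRows_injective (h1.symm.trans h2))
      · exact hpq (lowerRows_injective (h1.symm.trans h2)))
    (by
      rintro (_ | _) u v w ⟨p, q, hpq, h, h1, h2⟩ ⟨p', q', hpq', h', h1', h2'⟩
      · obtain rfl := upperRows_injective (h1.symm.trans h1')
        rw [h2, h2', eq_of_block_le_two ha hpq hpq' h h']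
      · obtain rfl := lowerRows_injective (h1.symm.trans h1')
        rw [h2, h2', eq_of_block_le_two hb hpq hpq' h h'])
    (outerRows p) t₀ ht₀
  refine ⟨v, ?_, ?_, t, hv, ?_⟩
  · intro q hq
    have hC : ∀ u w, StarEdge a b u w → u ∈ S → w ∈ S := by
      intro u w huw hu
      cases huw with
      | @upper p q h =>
        by_cases hpq : p = q
        · exact hpq ▸ hu
        · exact hcl false _ hu _ ⟨p, q, hpq, h, rfl, rfl⟩
      | @lower p q h =>
        by_cases hpq : p = q
        · exact hpq ▸ hu
        · exact hcl true _ hu _ ⟨p, q, hpq, h, rfl, rfl⟩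
    have hqS : outerRows q ∈ S := (star_invariant (C := fun u => u ∈ S) hC hq).1 hpS
    by_contra hne
    push Not at hne
    obtain ⟨s, hs⟩ := hmiss q
    obtain ⟨w, hw⟩ := hdeg _ hqS (fun h => hne.1 (outerRows_injective h)) hne.2 s
    exact hs w hw
  · refine Relation.EqvGen.mono (r := fun u w => ∃ s, PathEdge a b s u w) ?_ _ _ hconn
    rintro u w ⟨s, hs⟩
    exact hedge _ _ _ hs
  · intro h w
    have ht := hvp h
    rw [ht] at hv
    have h1 := hv w
    have h2 := ht₀ w
    rw [h] at h1
    rw [h]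
    cases t₀
    · exact ⟨h2, h1⟩
    · exact ⟨h1, h2⟩

theorem mul_block_le_two {a b : PartitionMonoid n} (ha : ∀ s ∈ a.blocks, s.ncard ≤ 2)
    (hb : ∀ s ∈ b.blocks, s.ncard ≤ 2) : ∀ s ∈ (a * b).blocks, s.ncard ≤ 2 := by
  rintro s ⟨p, rfl⟩
  have h2 : ∀ q, ({p, q} : Set (Fin n ⊕ Fin n)).ncard ≤ 2 := fun q =>
    (Set.ncard_insert_le _ _).trans (by rw [Set.ncard_singleton])
  obtain ⟨v, hv, -⟩ := exists_component ha hb p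
  by_cases h : ∃ q, outerRows q = v
  · obtain ⟨q, rfl⟩ := h
    refine (Set.ncard_le_ncard (t := {p, q}) ?_ (Set.toFinite _)).trans (h2 q)
    intro x hx
    rcases hv x ((a * b).rel.symm' hx) with h | h
    · exact Or.inl h
    · exact Or.inr (outerRows_injective h)
  · refine (Set.ncard_le_ncard (t := {p}) ?_ (Set.toFinite _)).trans (by simp)
    intro x hx
    rcases hv x ((a * b).rel.symm' hx) with h' | h'
    · exact h'
    · exact absurd ⟨x, h'⟩ h

theorem exists_ne_of_block_eq_two {a : PartitionMonoid n} (ha : ∀ s ∈ a.blocks, s.ncard = 2)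
    (p : Fin n ⊕ Fin n) : ∃ q, p ≠ q ∧ a.rel p q := by
  have h := ha _ (Setoid.mem_classes a.rel p)
  obtain ⟨q, hq, hne⟩ := Set.exists_ne_of_one_lt_ncard (s := {x | a.rel x p}) (by omega) p
  exact ⟨q, hne.symm, a.rel.symm' hq⟩

theorem mul_block_eq_two {a b : PartitionMonoid n} (ha : ∀ s ∈ a.blocks, s.ncard = 2)
    (hb : ∀ s ∈ b.blocks, s.ncard = 2) : ∀ s ∈ (a * b).blocks, s.ncard = 2 := by
  intro s hs
  refine le_antisymm (mul_block_le_two (fun s hs => (ha s hs).le) (fun s hs => (hb s hs).le) s hs) ?_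
  obtain ⟨p, rfl⟩ := hs
  obtain ⟨v, -, hconn, t, ht, hvp⟩ :=
    exists_component (fun s hs => (ha s hs).le) (fun s hs => (hb s hs).le) p
  have hA : ∀ q, ∃ w, PathEdge a b false (upperRows q) w := fun q =>
    let ⟨r, h1, h2⟩ := exists_ne_of_block_eq_two ha q
    ⟨upperRows r, q, r, h1, h2, rfl, rfl⟩
  have hB : ∀ q, ∃ w, PathEdge a b true (lowerRows q) w := fun q =>
    let ⟨r, h1, h2⟩ := exists_ne_of_block_eq_two hb q
    ⟨lowerRows r, q, r, h1, h2, rfl, rfl⟩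
  have hout : ∃ q, outerRows q = v := by
    rcases v with x | x | x
    · exact ⟨Sum.inl x, rfl⟩
    · exfalso
      cases t
      · obtain ⟨w, hw⟩ := hA (Sum.inr x)
        exact ht w hw
      · obtain ⟨w, hw⟩ := hB (Sum.inl x)
        exact ht w hw
    · exact ⟨Sum.inr x, rfl⟩
  obtain ⟨q, rfl⟩ := hout
  have hqp : q ≠ p := by
    rintro rfl
    rcases q with x | x
    · obtain ⟨w, hw⟩ := hA (Sum.inl x)
      exact (hvp rfl w).1 hw
    · obtain ⟨w, hw⟩ := hB (Sum.inr x)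
      exact (hvp rfl w).2 hw
  rw [← Set.ncard_pair hqp]
  refine Set.ncard_le_ncard ?_ (Set.toFinite _)
  rintro x (rfl | rfl)
  · exact (a * b).rel.symm' (mul_rel.2 hconn)
  · exact (a * b).rel.refl' _

theorem one_block_eq_two : ∀ s ∈ (1 : PartitionMonoid n).blocks, s.ncard = 2 := by
  rintro s ⟨p, rfl⟩
  rw [Set.ncard_eq_two]
  refine ⟨Sum.inl (Sum.elim id id p), Sum.inr (Sum.elim id id p), by simp, ?_⟩
  ext (x | x) <;> simp

end PartitionMonoid

/-- The partial Brauer monoid: all partitions whose blocks have size at most two. -/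
def partialBrauerMonoid (n : ℕ) : Submonoid (PartitionMonoid n) where
  carrier := {a | ∀ s ∈ a.blocks, s.ncard ≤ 2}
  mul_mem' := PartitionMonoid.mul_block_le_two
  one_mem' s hs := (PartitionMonoid.one_block_eq_two s hs).le

/-- The Brauer monoid: all partitions whose blocks have size two. -/
def brauerMonoid (n : ℕ) : Submonoid (PartitionMonoid n) where
  carrier := {a | ∀ s ∈ a.blocks, s.ncard = 2}
  mul_mem' := PartitionMonoid.mul_block_eq_two
  one_mem' := PartitionMonoid.one_block_eq_two

/-! ### Epigroups and trace conjugacy -/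

section Epigroup

variable {M : Type*} [Monoid M]

/-- `a` lies in the maximal subgroup of `M` whose identity element is the idempotent `e`. -/
def InMaximalSubgroup (e a : M) : Prop :=
  e * e = e ∧ e * a = a ∧ a * e = a ∧ ∃ x, e * x = x ∧ x * e = x ∧ a * x = e ∧ x * a = e

/-- `a` is a group element: it lies in some subgroup of `M`. -/
def IsGroupElement (a : M) : Prop := ∃ e, InMaximalSubgroup e a

/-- Some positive power of `a` lies in a subgroup of `M` with identity element `e`. -/
def IsOmega (a e : M) : Prop := ∃ k : ℕ, 0 < k ∧ InMaximalSubgroup e (a ^ k)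

/-- A monoid in which every element has a positive power that lies in a subgroup. -/
class IsEpigroup (M : Type*) [Monoid M] : Prop where
  exists_isOmega : ∀ a : M, ∃ e, IsOmega a e

theorem InMaximalSubgroup.pow {e a : M} (h : InMaximalSubgroup e a) {k : ℕ} (hk : 0 < k) :
    InMaximalSubgroup e (a ^ k) := by
  induction k, hk using Nat.le_induction with
  | base => simpa using h
  | succ k hk ih =>
    obtain ⟨he, h1, h2, x, h3, h4, h5, h6⟩ := h
    obtain ⟨-, i1, i2, y, i3, i4, i5, i6⟩ := ih
    refine ⟨he, ?_, ?_, x * y, ?_, ?_, ?_, ?_⟩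
    · rw [pow_succ, ← mul_assoc, i1]
    · rw [pow_succ, mul_assoc, h2]
    · rw [← mul_assoc, h3]
    · rw [mul_assoc, i4]
    · rw [pow_succ, mul_assoc, ← mul_assoc a x y, h5, i3, i5]
    · calc x * y * a ^ (k + 1) = x * (y * a ^ k) * a := by rw [pow_succ]; simp only [mul_assoc]
        _ = e := by rw [i6, h4, h6]

/-- The idempotent attached to `a` is unique. -/
theorem IsOmega.unique {a e f : M} (he : IsOmega a e) (hf : IsOmega a f) : e = f := by
  obtain ⟨k, hk, h⟩ := he
  obtain ⟨l, hl, h'⟩ := hf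
  have h1 := h.pow hl
  have h2 := h'.pow hk
  rw [← pow_mul] at h1
  rw [← pow_mul, mul_comm l k] at h2
  obtain ⟨-, a1, -, x, -, -, -, a4⟩ := h1
  obtain ⟨-, -, b2, y, -, -, b3, -⟩ := h2
  have e1 : e * f = e := by
    rw [← a4, mul_assoc, b2]
  have e2 : e * f = f := by
    rw [← b3, ← mul_assoc, a1]
  exact e1.symm.trans e2

/-- Every finite monoid is an epigroup. -/
instance (priority := 100) Finite.isEpigroup [Finite M] : IsEpigroup M where
  exists_isOmega a := by
    obtain ⟨i, j, hij, h⟩ := Finite.exists_ne_map_eq_of_infinite (fun k : ℕ => a ^ k)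
    wlog hlt : i < j generalizing i j
    · exact this j i hij.symm h.symm (by omega)
    obtain ⟨d, hd, rfl⟩ : ∃ d, 0 < d ∧ j = i + d := ⟨j - i, by omega, by omega⟩
    have hper : ∀ m, a ^ (i + d * m) = a ^ i := by
      intro m
      induction m with
      | zero => simp
      | succ m ih =>
        have : i + d * (m + 1) = (i + d * m) + d := by ring
        rw [this, pow_add, ih, ← pow_add]
        exact h.symm
    have hge : ∀ m c, i ≤ c → a ^ (c + d * m) = a ^ c := by
      intro m c hc
      obtain ⟨c, rfl⟩ := Nat.exists_eq_add_of_le hc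
      have : i + c + d * m = (i + d * m) + c := by ring
      rw [this, pow_add, hper, ← pow_add]
    have hi : i ≤ d * (i + 1) := by nlinarith
    have hidem : a ^ (d * (i + 1)) * a ^ (d * (i + 1)) = a ^ (d * (i + 1)) := by
      rw [← pow_add]
      exact hge (i + 1) _ hi
    exact ⟨a ^ (d * (i + 1)), d * (i + 1), by positivity, hidem, hidem, hidem,
      a ^ (d * (i + 1)), hidem, hidem, hidem, hidem⟩

/-- `a ^ ω`: the identity element of the subgroup of `M` in which some power of `a` lies. -/
noncomputable def omegaPow [IsEpigroup M] (a : M) : M := (IsEpigroup.exists_isOmega a).choose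

theorem omegaPow_spec [IsEpigroup M] (a : M) : IsOmega a (omegaPow a) :=
  (IsEpigroup.exists_isOmega a).choose_spec

/-- `a ^ (ω + 1) = a ^ ω * a`. -/
noncomputable def omegaSuccPow [IsEpigroup M] (a : M) : M := omegaPow a * a

/-- Trace conjugacy in an epigroup with identity. -/
def TraceConj [IsEpigroup M] (a b : M) : Prop :=
  ∃ g h : M, g * h * g = g ∧ h * g * h = h ∧ g * h = omegaPow a ∧ h * g = omegaPow b ∧
    h * omegaSuccPow a * g = omegaSuccPow b

end Epigroup

/-! ### Cycle types -/

/-- The cycle type `(k₁, …, kₘ)` of a permutation of an `m`-element set, where `kᵢ` is the number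
of cycles of length `i` (fixed points included); it is `(0)` for `m = 0`. -/
def permCycleType {m : ℕ} (σ : Equiv.Perm (Fin m)) : List ℕ :=
  if m = 0 then [0] else List.ofFn fun i : Fin m => σ.partition.parts.count ((i : ℕ) + 1)

namespace PartitionMonoid

variable {n : ℕ}

/-- `c` is the cycle type of the group element `a`: with `P₁, …, Pₘ` the blocks of the join of
`ker a` and `coker a` that intersect a transversal block, `Aᵢ ⊆ Pᵢ` the upper part and `Bᵢ' ⊆ Pᵢ'`
the lower part of a transversal block, `c` is the cycle type of the permutation `τ` with
`τ i = j` if and only if `Aᵢ ∪ Bⱼ'` is a block of `a`. -/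
def HasCycleType (a : PartitionMonoid n) (c : List ℕ) : Prop :=
  IsGroupElement a ∧ ∃ (m : ℕ) (P A B : Fin m → Set (Fin n)) (τ : Equiv.Perm (Fin m)),
    Function.Injective P ∧ Set.range P = a.activeBlocks ∧
    (∀ i, A i ∈ a.kerT ∧ A i ⊆ P i) ∧ (∀ i, B i ∈ a.cokerT ∧ B i ⊆ P i) ∧
    (∀ i j, τ i = j ↔ a.IsTransversal (Sum.inl '' A i ∪ Sum.inr '' B j)) ∧
    c = permCycleType τ

/-- `a` and `b` are group elements with the same cycle type. -/
def SameCycleType (a b : PartitionMonoid n) : Prop := ∃ c, a.HasCycleType c ∧ b.HasCycleType c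

end PartitionMonoid

/-! Put `e = a ^ ω` and `a' = a ^ (ω + 1)`. List the transversal blocks of `e` as `A i ∪ (B i)'`.
Since `e` is idempotent, every class of `ker e ⊔ coker e` that meets some `A i` or `B i` contains
exactly one of each, with equal index (`Presents.linked`). An element of the maximal subgroup at `e`
has the kernel, cokernel, domain and codomain of `e`, so it differs from `e` only in how upper parts
are matched with lower parts: its transversal blocks are `A i ∪ (B (τ i))'` for a permutation `τ`
(`InMaximalSubgroup.exists_perm`). The cycle type of `a'` is that of `τ`.

Products of such presented partitions are computed index by index whenever the middle families are
linked (`Presents.mul`). If `g`, `h` witness trace conjugacy, then `g` has the upper structure of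
`e`, and `h` has its lower structure. Transporting the families of `e` along `g` and `h` presents `b
^ ω` and `b ^ (ω + 1)` with the same `τ`.

Conversely, equal cycle types make the two permutations conjugate. After reindexing they coincide,
and one takes for `g` the partition with the upper blocks of `a ^ ω` and the lower blocks of `b ^
ω`, for `h` the opposite one. In the Brauer monoids these two stay inside: their transversal blocks
have size two, and every other block is a block of one of the idempotents (`Presents.block_size`).
-/

section Epigroup

/-! ### Maximal subgroups and homomorphisms of epigroups -/

variable {M : Type*} [Monoid M]

/-- Since `e = a ^ k * x = x * a ^ k` and `a` commutes with `a ^ k`, both sides equal `e * a * e`.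
-/
theorem IsOmega.mul_comm {a e : M} (h : IsOmega a e) : e * a = a * e := by
  obtain ⟨k, -, he, h1, h2, x, h3, h4, h5, h6⟩ := h
  have hc : a * a ^ k = a ^ k * a := (pow_succ' a k).symm.trans (pow_succ a k)
  have e1 : a * e = e * a * e := by
    rw [← h5, ← mul_assoc, hc]
    conv_lhs => rw [← h1]
    rw [← h5]
    simp only [mul_assoc]
    rw [← mul_assoc a, hc]
    simp only [mul_assoc]
  have e2 : e * a = e * a * e := by
    conv_lhs => rw [← h6, mul_assoc, ← hc, ← h2]
    rw [← mul_assoc a, hc, ← h6]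
    simp only [mul_assoc]
  exact e2.trans e1.symm

/-- With `k = l + 1` and `x` the inverse of `a ^ k` in the subgroup, the inverse of `e * a` is `a ^
l * x`; this rests on `x` commuting with `a`. -/
theorem IsOmega.inMaximalSubgroup_mul {a e : M} (h : IsOmega a e) :
    InMaximalSubgroup e (e * a) := by
  have hcomm := h.mul_comm
  obtain ⟨k, hk, he, h1, h2, x, h3, h4, h5, h6⟩ := h
  obtain ⟨l, rfl⟩ : ∃ l, k = l + 1 := ⟨k - 1, by omega⟩
  have hx : x * a = a * x := by
    calc x * a = x * (e * a) := by rw [← mul_assoc, h4]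
      _ = x * (a * (a ^ (l + 1) * x)) := by rw [hcomm, h5]
      _ = x * a ^ (l + 1) * a * x := by
        rw [← mul_assoc a, ← pow_succ', pow_succ a (l + 1)]; simp only [mul_assoc]
      _ = a * x := by rw [h6, hcomm, mul_assoc, h3]
  have hel : e * a ^ l = a ^ l * e := (Commute.pow_right (show Commute e a from hcomm) l)
  refine ⟨he, by rw [← mul_assoc, he], by rw [mul_assoc, ← hcomm, ← mul_assoc, he],
    a ^ l * x, ?_, ?_, ?_, ?_⟩
  · rw [← mul_assoc, hel, mul_assoc, h3]
  · rw [mul_assoc, h4]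
  · rw [mul_assoc, ← mul_assoc a, ← pow_succ', h5, he]
  · rw [mul_assoc, ← mul_assoc x, h4, hx, ← mul_assoc, ← pow_succ, h5]

theorem omegaSuccPow_spec [IsEpigroup M] (a : M) :
    InMaximalSubgroup (omegaPow a) (omegaSuccPow a) :=
  (omegaPow_spec a).inMaximalSubgroup_mul

theorem InMaximalSubgroup.map {N : Type*} [Monoid N] (f : M →* N) {e a : M}
    (h : InMaximalSubgroup e a) : InMaximalSubgroup (f e) (f a) := by
  obtain ⟨he, h1, h2, x, h3, h4, h5, h6⟩ := h
  exact ⟨by rw [← map_mul, he], by rw [← map_mul, h1], by rw [← map_mul, h2], f x,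
    by rw [← map_mul, h3], by rw [← map_mul, h4], by rw [← map_mul, h5], by rw [← map_mul, h6]⟩

/-- Uniqueness of the idempotent makes the chosen `omegaPow` compatible with homomorphisms. Applied
to the inclusion of a submonoid, this reduces the Brauer cases to computations in the full partition
monoid. -/
theorem map_omegaPow {N : Type*} [Monoid N] [IsEpigroup M] [IsEpigroup N] (f : M →* N) (a : M) :
    f (omegaPow a) = omegaPow (f a) := by
  obtain ⟨k, hk, h⟩ := omegaPow_spec a
  exact IsOmega.unique ⟨k, hk, by simpa using h.map f⟩ (omegaPow_spec (f a))

theorem map_omegaSuccPow {N : Type*} [Monoid N] [IsEpigroup M] [IsEpigroup N] (f : M →* N)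
    (a : M) : f (omegaSuccPow a) = omegaSuccPow (f a) := by
  rw [omegaSuccPow, omegaSuccPow, map_mul, map_omegaPow]

theorem TraceConj.map {N : Type*} [Monoid N] [IsEpigroup M] [IsEpigroup N] (f : M →* N)
    {a b : M} (h : TraceConj a b) : TraceConj (f a) (f b) := by
  obtain ⟨g, h, h1, h2, h3, h4, h5⟩ := h
  exact ⟨f g, f h, by simp only [← map_mul, h1], by simp only [← map_mul, h2],
    by rw [← map_mul, h3, map_omegaPow], by rw [← map_mul, h4, map_omegaPow],
    by rw [← map_omegaSuccPow, ← map_omegaSuccPow, ← map_mul, ← map_mul, h5]⟩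

end Epigroup

/-! ### Cycle types and conjugacy of permutations -/

theorem isConj_of_permCycleType_eq {m : ℕ} {σ τ : Equiv.Perm (Fin m)}
    (h : permCycleType σ = permCycleType τ) : IsConj σ τ := by
  rcases Nat.eq_zero_or_pos m with rfl | hm
  · rw [Subsingleton.elim σ τ]
  · rw [permCycleType, permCycleType, if_neg hm.ne', if_neg hm.ne', List.ofFn_inj] at h
    refine Equiv.Perm.partition_eq_of_isConj.2 (Nat.Partition.ext (Multiset.ext.2 fun k => ?_))
    -- The list records only the counts of parts `1, …, m`, entry `i` belonging to size `i + 1`; all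
    -- other counts vanish.
    have hzero : ∀ ρ : Equiv.Perm (Fin m), (k = 0 ∨ m < k) → ρ.partition.parts.count k = 0 := by
      intro ρ hk
      refine Multiset.count_eq_zero.2 fun hmem => ?_
      have h1 := ρ.partition.parts_pos hmem
      have h2 := ρ.partition.le_of_mem_parts hmem
      rw [Fintype.card_fin] at h2
      omega
    by_cases hk : k = 0 ∨ m < k
    · rw [hzero σ hk, hzero τ hk]
    · push Not at hk
      have := congrFun h ⟨k - 1, by omega⟩
      simpa [Nat.sub_add_cancel (Nat.pos_of_ne_zero hk.1)] using this

/-- The degree is the length of the list, except that degree zero gives `[0]`, of length one. No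
confusion arises with degree one, where the fixed point gives `[1]`. -/
theorem eq_of_permCycleType_eq {m m' : ℕ} {σ : Equiv.Perm (Fin m)} {τ : Equiv.Perm (Fin m')}
    (h : permCycleType σ = permCycleType τ) : m = m' := by
  have key : ∀ {m : ℕ} {τ : Equiv.Perm (Fin m)}, permCycleType τ = [0] → m = 0 := by
    intro m τ h
    by_contra hm
    rw [permCycleType, if_neg hm] at h
    have hm1 : m = 1 := by simpa using congrArg List.length h
    subst hm1
    have hp : τ.partition.parts.sum = 1 := by simpa using τ.partition.parts_sum
    have hc : τ.partition.parts.count 1 = 0 := by simpa using h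
    have hle : ∀ k ∈ τ.partition.parts, k = 1 := fun k hk => by
      have h1 := τ.partition.parts_pos hk
      have h2 := τ.partition.le_of_mem_parts hk
      rw [Fintype.card_fin] at h2
      omega
    have h0 : τ.partition.parts = 0 := Multiset.eq_zero_of_forall_notMem fun k hk =>
      Multiset.count_eq_zero.1 hc (hle k hk ▸ hk)
    simp [h0] at hp
  by_cases hm : m = 0
  · exact hm.trans (key (h.symm.trans (if_pos hm))).symm
  · by_cases hm' : m' = 0
    · exact (key (h.trans (if_pos hm'))).trans hm'.symm
    · rw [permCycleType, permCycleType, if_neg hm, if_neg hm'] at h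
      simpa using congrArg List.length h

namespace PartitionMonoid

variable {n : ℕ} {ι κ : Type*} {K L K' L' : Setoid (Fin n)} {A B A' B' : ι → Set (Fin n)}
  {a b c e : PartitionMonoid n}

/-! ### Blocks of a product -/

theorem star_mid {z w : Fin n} (h : (a.coker ⊔ b.ker) z w) :
    star a b (Sum.inr (Sum.inl z)) (Sum.inr (Sum.inl w)) := by
  have hle : a.coker ⊔ b.ker ≤ (star a b).comap fun x => Sum.inr (Sum.inl x) :=
    sup_le (fun {x y} h => .rel _ _ (.upper (p := Sum.inr x) (q := Sum.inr y) h))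
      (fun {x y} h => .rel _ _ (.lower (p := Sum.inl x) (q := Sum.inl y) h))
  exact hle h

theorem le_sup_left_apply {x y : Fin n} (h : K x y) : (K ⊔ L) x y :=
  (le_sup_left : K ≤ K ⊔ L) h

theorem le_sup_right_apply {x y : Fin n} (h : L x y) : (K ⊔ L) x y :=
  (le_sup_right : L ≤ K ⊔ L) h

theorem star_upper {x z : Fin n} (h : a.rel (Sum.inl x) (Sum.inr z)) :
    star a b (Sum.inl x) (Sum.inr (Sum.inl z)) :=
  .rel _ _ (.upper (p := Sum.inl x) (q := Sum.inr z) h)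

theorem star_lower {w y : Fin n} (h : b.rel (Sum.inl w) (Sum.inr y)) :
    star a b (Sum.inr (Sum.inl w)) (Sum.inr (Sum.inr y)) :=
  .rel _ _ (.lower (p := Sum.inl w) (q := Sum.inr y) h)

theorem mul_rel_of_upper {x x' : Fin n} (h : a.rel (Sum.inl x) (Sum.inl x')) :
    (a * b).rel (Sum.inl x) (Sum.inl x') :=
  .rel _ _ (.upper (p := Sum.inl x) (q := Sum.inl x') h)

theorem mul_rel_of_lower {y y' : Fin n} (h : b.rel (Sum.inr y) (Sum.inr y')) :
    (a * b).rel (Sum.inr y) (Sum.inr y') :=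
  .rel _ _ (.lower (p := Sum.inr y) (q := Sum.inr y') h)

/-- The component of the upper point `x` in the diagram of `a` over `b`. -/
theorem mem_component_upper {x : Fin n} {v : Rows n} (h : star a b (Sum.inl x) v) :
    Sum.elim
      (fun x' => a.rel (Sum.inl x) (Sum.inl x') ∨ ∃ z w, a.rel (Sum.inl x) (Sum.inr z) ∧
        (a.coker ⊔ b.ker) z w ∧ a.rel (Sum.inl x') (Sum.inr w))
      (Sum.elim (fun w => ∃ z, a.rel (Sum.inl x) (Sum.inr z) ∧ (a.coker ⊔ b.ker) z w)
        (fun y => ∃ z w, a.rel (Sum.inl x) (Sum.inr z) ∧ (a.coker ⊔ b.ker) z w ∧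
          b.rel (Sum.inl w) (Sum.inr y))) v := by
  refine (star_invariant ?_ h).1 (Or.inl (a.rel.refl' _))
  intro u v huv hu
  cases huv with
  | @upper p q hpq =>
    rcases p with p | p <;> rcases q with q | q
    · rcases hu with hu | ⟨z, w, h1, h2, h3⟩
      · exact Or.inl (a.rel.trans' hu hpq)
      · exact Or.inr ⟨z, w, h1, h2, a.rel.trans' (a.rel.symm' hpq) h3⟩
    · rcases hu with hu | ⟨z, w, h1, h2, h3⟩
      · exact ⟨q, a.rel.trans' hu hpq, Setoid.refl' _ _⟩
      · exact ⟨z, h1, Setoid.trans' _ h2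
          (le_sup_left_apply (a.rel.trans' (a.rel.symm' h3) hpq))⟩
    · obtain ⟨z, h1, h2⟩ := hu
      exact Or.inr ⟨z, p, h1, h2, a.rel.symm' hpq⟩
    · obtain ⟨z, h1, h2⟩ := hu
      exact ⟨z, h1, Setoid.trans' _ h2 (le_sup_left_apply hpq)⟩
  | @lower p q hpq =>
    rcases p with p | p <;> rcases q with q | q
    · obtain ⟨z, h1, h2⟩ := hu
      exact ⟨z, h1, Setoid.trans' _ h2 (le_sup_right_apply hpq)⟩
    · obtain ⟨z, h1, h2⟩ := hu
      exact ⟨z, p, h1, h2, hpq⟩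
    · obtain ⟨z, w, h1, h2, h3⟩ := hu
      exact ⟨z, h1, Setoid.trans' _ h2
        (le_sup_right_apply (b.rel.trans' h3 hpq))⟩
    · obtain ⟨z, w, h1, h2, h3⟩ := hu
      exact ⟨z, w, h1, h2, b.rel.trans' h3 hpq⟩

/-- The component of the lower point `y` in the diagram of `a` over `b`, restricted to the middle
and the bottom row. -/
theorem mem_component_lower {y : Fin n} {v : Rows n} (h : star a b (Sum.inr (Sum.inr y)) v) :
    Sum.elim
      (fun x' => ∃ z w, b.rel (Sum.inl z) (Sum.inr y) ∧ (a.coker ⊔ b.ker) z w ∧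
          a.rel (Sum.inl x') (Sum.inr w))
      (Sum.elim (fun w => ∃ z, b.rel (Sum.inl z) (Sum.inr y) ∧ (a.coker ⊔ b.ker) z w)
        (fun y' => b.rel (Sum.inr y) (Sum.inr y') ∨ ∃ z w, b.rel (Sum.inl z) (Sum.inr y) ∧
        (a.coker ⊔ b.ker) z w ∧ b.rel (Sum.inl w) (Sum.inr y'))) v := by
  refine (star_invariant ?_ h).1 (Or.inl (b.rel.refl' _))
  intro u v huv hu
  cases huv with
  | @upper p q hpq =>
    rcases p with p | p <;> rcases q with q | q
    · obtain ⟨z, w, h1, h2, h3⟩ := hu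
      exact ⟨z, w, h1, h2, a.rel.trans' (a.rel.symm' hpq) h3⟩
    · obtain ⟨z, w, h1, h2, h3⟩ := hu
      exact ⟨z, h1, Setoid.trans' _ h2
        (le_sup_left_apply (a.rel.trans' (a.rel.symm' h3) hpq))⟩
    · obtain ⟨z, h1, h2⟩ := hu
      exact ⟨z, p, h1, h2, a.rel.symm' hpq⟩
    · obtain ⟨z, h1, h2⟩ := hu
      exact ⟨z, h1, Setoid.trans' _ h2 (le_sup_left_apply hpq)⟩
  | @lower p q hpq =>
    rcases p with p | p <;> rcases q with q | q
    · obtain ⟨z, h1, h2⟩ := hu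
      exact ⟨z, h1, Setoid.trans' _ h2 (le_sup_right_apply hpq)⟩
    · obtain ⟨z, h1, h2⟩ := hu
      exact Or.inr ⟨z, p, h1, h2, hpq⟩
    · rcases hu with hu | ⟨z, w, h1, h2, h3⟩
      · exact ⟨q, b.rel.symm' (b.rel.trans' hu hpq), Setoid.refl' _ _⟩
      · exact ⟨z, h1, Setoid.trans' _ h2 (le_sup_right_apply (b.rel.trans' h3 hpq))⟩
    · rcases hu with hu | ⟨z, w, h1, h2, h3⟩
      · exact Or.inl (b.rel.trans' hu hpq)
      · exact Or.inr ⟨z, w, h1, h2, b.rel.trans' h3 hpq⟩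

/-- A path from top to bottom may return to the outer rows several times, but an excursion from the
middle row through `a` or `b` back to it is already a step of `coker a` or `ker b`. Hence one entry,
one step in the join and one exit suffice. -/
theorem mul_rel_cross {x y : Fin n} : (a * b).rel (Sum.inl x) (Sum.inr y) ↔
    ∃ z w, a.rel (Sum.inl x) (Sum.inr z) ∧ (a.coker ⊔ b.ker) z w ∧
      b.rel (Sum.inl w) (Sum.inr y) := by
  refine ⟨fun h => mem_component_upper h, ?_⟩
  rintro ⟨z, w, h1, h2, h3⟩
  exact (star a b).trans' (star_upper h1) ((star a b).trans' (star_mid h2) (star_lower h3))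

theorem mul_rel_upper {x x' : Fin n} : (a * b).rel (Sum.inl x) (Sum.inl x') ↔
    a.rel (Sum.inl x) (Sum.inl x') ∨ ∃ z w, a.rel (Sum.inl x) (Sum.inr z) ∧
        (a.coker ⊔ b.ker) z w ∧ a.rel (Sum.inl x') (Sum.inr w) := by
  refine ⟨fun h => mem_component_upper h, ?_⟩
  rintro (h | ⟨z, w, h1, h2, h3⟩)
  · exact mul_rel_of_upper h
  · exact (star a b).trans' (star_upper h1)
      ((star a b).trans' (star_mid h2) ((star a b).symm' (star_upper h3)))

theorem mul_rel_lower {y y' : Fin n} : (a * b).rel (Sum.inr y) (Sum.inr y') ↔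
    b.rel (Sum.inr y) (Sum.inr y') ∨ ∃ z w, b.rel (Sum.inl z) (Sum.inr y) ∧
        (a.coker ⊔ b.ker) z w ∧ b.rel (Sum.inl w) (Sum.inr y') := by
  refine ⟨fun h => mem_component_lower h, ?_⟩
  rintro (h | ⟨z, w, h1, h2, h3⟩)
  · exact mul_rel_of_lower h
  · exact (star a b).trans' ((star a b).symm' (star_lower h1))
      ((star a b).trans' (star_mid h2) (star_lower h3))

theorem mem_dom {x : Fin n} : x ∈ a.dom ↔ ∃ y, a.rel (Sum.inl x) (Sum.inr y) := by
  constructor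
  · rintro ⟨s, ⟨⟨p, rfl⟩, -, y, hy⟩, hx⟩
    exact ⟨y, a.rel.trans' hx (a.rel.symm' hy)⟩
  · rintro ⟨y, h⟩
    exact ⟨_, ⟨Setoid.mem_classes a.rel (Sum.inl x), ⟨x, a.rel.refl' _⟩, y, a.rel.symm' h⟩,
      a.rel.refl' _⟩

theorem mem_codom {y : Fin n} : y ∈ a.codom ↔ ∃ x, a.rel (Sum.inl x) (Sum.inr y) := by
  constructor
  · rintro ⟨s, ⟨⟨p, rfl⟩, ⟨x, hx⟩, -⟩, hy⟩
    exact ⟨x, a.rel.trans' hx (a.rel.symm' hy)⟩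
  · rintro ⟨x, h⟩
    exact ⟨_, ⟨Setoid.mem_classes a.rel (Sum.inr y), ⟨x, h⟩, y, a.rel.refl' _⟩,
      a.rel.refl' _⟩

/-- Right multiplication can only coarsen the kernel, and here each of `a`, `c` is a right multiple
of the other. The next three lemmas are the analogues for cokernel, domain and codomain; the last
two shrink under multiplication. -/
theorem ker_eq_of_mul {d : PartitionMonoid n} (h1 : a * b = c) (h2 : c * d = a) :
    c.ker = a.ker := by
  subst h1
  refine le_antisymm (fun {x y} h => ?_) (fun {x y} h => mul_rel_of_upper h)
  change a.rel _ _
  rw [← h2]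
  exact mul_rel_of_upper h

theorem coker_eq_of_mul {d : PartitionMonoid n} (h1 : b * a = c) (h2 : d * c = a) :
    c.coker = a.coker := by
  subst h1
  refine le_antisymm (fun {x y} h => ?_) (fun {x y} h => mul_rel_of_lower h)
  change a.rel _ _
  rw [← h2]
  exact mul_rel_of_lower h

theorem dom_eq_of_mul {d : PartitionMonoid n} (h1 : a * b = c) (h2 : c * d = a) :
    c.dom = a.dom := by
  have key : ∀ a b : PartitionMonoid n, (a * b).dom ⊆ a.dom := by
    intro a b x hx
    obtain ⟨y, hy⟩ := mem_dom.1 hx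
    obtain ⟨z, -, hz, -⟩ := mul_rel_cross.1 hy
    exact mem_dom.2 ⟨z, hz⟩
  exact Set.Subset.antisymm (h1 ▸ key a b) (h2 ▸ key c d)

theorem codom_eq_of_mul {d : PartitionMonoid n} (h1 : b * a = c) (h2 : d * c = a) :
    c.codom = a.codom := by
  have key : ∀ a b : PartitionMonoid n, (b * a).codom ⊆ a.codom := by
    intro a b x hx
    obtain ⟨y, hy⟩ := mem_codom.1 hx
    obtain ⟨-, w, -, -, hw⟩ := mul_rel_cross.1 hy
    exact mem_codom.2 ⟨w, hw⟩
  exact Set.Subset.antisymm (h1 ▸ key a b) (h2 ▸ key c d)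

/-! ### Partitions presented by families of kernel and cokernel classes -/

/-- `A` is a family of distinct equivalence classes of `K`. -/
structure ClassFamily (K : Setoid (Fin n)) (A : ι → Set (Fin n)) : Prop where
  nonempty : ∀ i, (A i).Nonempty
  mem_of_rel {i : ι} {x y : Fin n} : x ∈ A i → K x y → y ∈ A i
  rel_iff : ∀ {i j x y}, x ∈ A i → y ∈ A j → (K x y ↔ i = j)

/-- `a` has kernel `K`, cokernel `L`, and its transversal blocks are the sets `A i ∪ (B i)'`. -/
structure Presents (a : PartitionMonoid n) (K L : Setoid (Fin n)) (A B : ι → Set (Fin n)) :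
    Prop where
  upper : ∀ {x x'}, a.rel (Sum.inl x) (Sum.inl x') ↔ K x x'
  lower : ∀ {y y'}, a.rel (Sum.inr y) (Sum.inr y') ↔ L y y'
  cross : ∀ {x y}, a.rel (Sum.inl x) (Sum.inr y) ↔ ∃ i, x ∈ A i ∧ y ∈ B i

/-- Each class of `J` that meets some `B i` or `A i` meets both, and no `B j` or `A j` for
`j ≠ i`. -/
def Linked (J : Setoid (Fin n)) (B A : ι → Set (Fin n)) : Prop :=
  ∀ ⦃i j z w⦄, z ∈ B i → w ∈ A j → (J z w ↔ i = j)

theorem ClassFamily.eq_index (hA : ClassFamily K A) {i j : ι} {x : Fin n} (h1 : x ∈ A i)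
    (h2 : x ∈ A j) : i = j :=
  (hA.rel_iff h1 h2).1 (K.refl' x)

theorem ClassFamily.comp (hA : ClassFamily K A) {f : κ → ι} (hf : f.Injective) :
    ClassFamily K (A ∘ f) where
  nonempty _ := hA.nonempty _
  mem_of_rel h1 h2 := hA.mem_of_rel h1 h2
  rel_iff h1 h2 := (hA.rel_iff h1 h2).trans hf.eq_iff

theorem Linked.comp {J : Setoid (Fin n)} (h : Linked J B A) {f : κ → ι} (hf : f.Injective) :
    Linked J (B ∘ f) (A ∘ f) :=
  fun _ _ _ _ h1 h2 => (h h1 h2).trans hf.eq_iff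

theorem Presents.comp (h : Presents a K L A B) {f : κ → ι} (hf : f.Surjective) :
    Presents a K L (A ∘ f) (B ∘ f) where
  upper := h.upper
  lower := h.lower
  cross := h.cross.trans hf.exists

theorem Presents.ker_eq (h : Presents a K L A B) : a.ker = K := Setoid.ext fun _ _ => h.upper

theorem Presents.coker_eq (h : Presents a K L A B) : a.coker = L := Setoid.ext fun _ _ => h.lower

theorem Presents.mem_dom_iff (h : Presents a K L A B) (hB : ClassFamily L B) {x : Fin n} :
    x ∈ a.dom ↔ ∃ i, x ∈ A i := by
  rw [mem_dom]
  constructor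
  · rintro ⟨y, hy⟩
    obtain ⟨i, hi, -⟩ := h.cross.1 hy
    exact ⟨i, hi⟩
  · rintro ⟨i, hi⟩
    obtain ⟨y, hy⟩ := hB.nonempty i
    exact ⟨y, h.cross.2 ⟨i, hi, hy⟩⟩

theorem Presents.mem_codom_iff (h : Presents a K L A B) (hA : ClassFamily K A) {y : Fin n} :
    y ∈ a.codom ↔ ∃ i, y ∈ B i := by
  rw [mem_codom]
  constructor
  · rintro ⟨x, hx⟩
    obtain ⟨i, -, hi⟩ := h.cross.1 hx
    exact ⟨i, hi⟩
  · rintro ⟨i, hi⟩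
    obtain ⟨x, hx⟩ := hA.nonempty i
    exact ⟨x, h.cross.2 ⟨i, hx, hi⟩⟩

theorem Presents.eq (ha : Presents a K L A B) (hb : Presents b K L A B) : a = b := by
  ext (p | p) (q | q)
  · exact ha.upper.trans hb.upper.symm
  · exact ha.cross.trans hb.cross.symm
  · exact ⟨fun h => b.rel.symm' (hb.cross.2 (ha.cross.1 (a.rel.symm' h))),
      fun h => a.rel.symm' (ha.cross.2 (hb.cross.1 (b.rel.symm' h)))⟩
  · exact ha.lower.trans hb.lower.symm

/-- Gluing the `i`-th class of `K` to the `i`-th class of `L` is transitive because distinct indices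
carry distinct classes. This is the source of the conjugating elements. -/
theorem exists_presents (hA : ClassFamily K A) (hB : ClassFamily L B) :
    ∃ a : PartitionMonoid n, Presents a K L A B := by
  let r : Fin n ⊕ Fin n → Fin n ⊕ Fin n → Prop := fun p q =>
    Sum.elim (fun x => Sum.elim (fun x' => K x x') (fun y => ∃ i, x ∈ A i ∧ y ∈ B i) q)
      (fun y => Sum.elim (fun x => ∃ i, x ∈ A i ∧ y ∈ B i) (fun y' => L y y') q) p
  refine ⟨⟨⟨r, ?_, ?_, ?_⟩⟩, Iff.rfl, Iff.rfl, Iff.rfl⟩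
  · rintro (x | y)
    · exact K.refl' x
    · exact L.refl' y
  · rintro (x | y) (x' | y') h
    · exact K.symm' h
    · exact h
    · exact h
    · exact L.symm' h
  · rintro (x | y) (x' | y') (x'' | y'') h1 h2
    · exact K.trans' h1 h2
    · obtain ⟨i, h3, h4⟩ := h2
      exact ⟨i, hA.mem_of_rel h3 (K.symm' h1), h4⟩
    · obtain ⟨i, h3, h4⟩ := h1
      obtain ⟨j, h5, h6⟩ := h2
      exact (hA.rel_iff h3 h5).2 (hB.eq_index h4 h6)
    · obtain ⟨i, h3, h4⟩ := h1
      exact ⟨i, h3, hB.mem_of_rel h4 h2⟩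
    · obtain ⟨i, h3, h4⟩ := h1
      exact ⟨i, hA.mem_of_rel h3 h2, h4⟩
    · obtain ⟨i, h3, h4⟩ := h1
      obtain ⟨j, h5, h6⟩ := h2
      exact (hB.rel_iff h4 h6).2 (hA.eq_index h3 h5)
    · obtain ⟨i, h3, h4⟩ := h2
      exact ⟨i, h3, hB.mem_of_rel h4 (L.symm' h1)⟩
    · exact L.trans' h1 h2

theorem Linked.eq_left {J : Setoid (Fin n)} (h : Linked J B A) (hA : ClassFamily K A) {i j : ι}
    {z w : Fin n} (hz : z ∈ B i) (hw : w ∈ B j) (hzw : J z w) : i = j := by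
  obtain ⟨v, hv⟩ := hA.nonempty j
  exact (h hz hv).1 (J.trans' hzw ((h hw hv).2 rfl))

theorem Linked.eq_right {J : Setoid (Fin n)} (h : Linked J B A) (hB : ClassFamily L B) {i j : ι}
    {z w : Fin n} (hz : z ∈ A i) (hw : w ∈ A j) (hzw : J z w) : i = j := by
  obtain ⟨v, hv⟩ := hB.nonempty i
  exact (h hv hw).1 (J.trans' ((h hv hz).2 rfl) hzw)

/-- Linkedness says that the middle row connects the lower part `B i` to the upper part `A' i` and
to no part of another index. So no two transversal blocks of one factor are merged, the outer kernel
and cokernel do not grow, and transversal blocks compose index by index. -/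
theorem Presents.mul (ha : Presents a K L A B) (hb : Presents b K' L' A' B')
    (hA : ClassFamily K A) (hB : ClassFamily L B) (hA' : ClassFamily K' A')
    (hB' : ClassFamily L' B') (h : Linked (L ⊔ K') B A') :
    Presents (a * b) K L' A B' := by
  have hJ : a.coker ⊔ b.ker = L ⊔ K' := by rw [ha.coker_eq, hb.ker_eq]
  refine ⟨fun {x x'} => ?_, fun {y y'} => ?_, fun {x y} => ?_⟩
  · rw [mul_rel_upper, hJ, ha.upper]
    refine ⟨?_, Or.inl⟩
    rintro (h1 | ⟨z, w, h1, h2, h3⟩)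
    · exact h1
    · obtain ⟨i, hi, hi'⟩ := ha.cross.1 h1
      obtain ⟨j, hj, hj'⟩ := ha.cross.1 h3
      exact (hA.rel_iff hi hj).2 (h.eq_left hA' hi' hj' h2)
  · rw [mul_rel_lower, hJ, hb.lower]
    refine ⟨?_, Or.inl⟩
    rintro (h1 | ⟨z, w, h1, h2, h3⟩)
    · exact h1
    · obtain ⟨i, hi, hi'⟩ := hb.cross.1 h1
      obtain ⟨j, hj, hj'⟩ := hb.cross.1 h3
      exact (hB'.rel_iff hi' hj').2 (h.eq_right hB hi hj h2)
  · rw [mul_rel_cross, hJ]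
    constructor
    · rintro ⟨z, w, h1, h2, h3⟩
      obtain ⟨i, hi, hi'⟩ := ha.cross.1 h1
      obtain ⟨j, hj, hj'⟩ := hb.cross.1 h3
      obtain rfl := (h hi' hj).1 h2
      exact ⟨i, hi, hj'⟩
    · rintro ⟨i, h1, h2⟩
      obtain ⟨z, hz⟩ := hB.nonempty i
      obtain ⟨w, hw⟩ := hA'.nonempty i
      exact ⟨z, w, ha.cross.2 ⟨i, h1, hz⟩, (h hz hw).2 rfl, hb.cross.2 ⟨i, hw, h2⟩⟩

/-- A connection from `B i` to `A j` in the middle row joins `A i` to `(B j)'` in `e * e = e`, which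
forces `i = j`. Conversely, the block `A i ∪ (B i)'` of `e * e` needs such a connection for `j = i`.
-/
theorem Presents.linked (he : Presents e K L A B) (hA : ClassFamily K A) (hB : ClassFamily L B)
    (hee : e * e = e) : Linked (K ⊔ L) B A := by
  have hJ : e.coker ⊔ e.ker = K ⊔ L := by rw [he.coker_eq, he.ker_eq, sup_comm]
  intro i j z w hz hw
  constructor
  · intro h
    obtain ⟨x, hx⟩ := hA.nonempty i
    obtain ⟨y, hy⟩ := hB.nonempty j
    have : e.rel (Sum.inl x) (Sum.inr y) := by
      rw [← hee, mul_rel_cross, hJ]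
      exact ⟨z, w, he.cross.2 ⟨i, hx, hz⟩, h, he.cross.2 ⟨j, hw, hy⟩⟩
    obtain ⟨k, hk, hk'⟩ := he.cross.1 this
    exact (hA.eq_index hx hk).trans (hB.eq_index hk' hy)
  · rintro rfl
    have : e.rel (Sum.inl w) (Sum.inr z) := he.cross.2 ⟨i, hw, hz⟩
    rw [← hee, mul_rel_cross, hJ] at this
    -- The path leaves the upper copy of `e` at a point of `B i` and enters the lower copy at a
    -- point of `A i`.
    obtain ⟨z', w', h1, h2, h3⟩ := this
    obtain ⟨k, hk, hk'⟩ := he.cross.1 h1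
    obtain rfl := hA.eq_index hw hk
    obtain ⟨k, hl, hl'⟩ := he.cross.1 h3
    obtain rfl := hB.eq_index hz hl'
    exact Setoid.trans' _ (le_sup_right_apply ((hB.rel_iff hz hk').2 rfl))
      (Setoid.trans' _ h2 (le_sup_left_apply ((hA.rel_iff hl hw).2 rfl)))

/-- The families attached to the upper parts of transversal blocks. -/
theorem exists_presents_upper (hA : ClassFamily a.ker A) (hdom : ∀ x, x ∈ a.dom ↔ ∃ i, x ∈ A i) :
    ∃ B : ι → Set (Fin n), ClassFamily a.coker B ∧ Presents a a.ker a.coker A B := by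
  refine ⟨fun i => {y | ∃ x ∈ A i, a.rel (Sum.inl x) (Sum.inr y)}, ⟨?_, ?_, ?_⟩,
    Iff.rfl, Iff.rfl, ?_⟩
  · intro i
    obtain ⟨x, hx⟩ := hA.nonempty i
    obtain ⟨y, hy⟩ := mem_dom.1 ((hdom x).2 ⟨i, hx⟩)
    exact ⟨y, x, hx, hy⟩
  · rintro i y y' ⟨x, hx, h⟩ h'
    exact ⟨x, hx, a.rel.trans' h h'⟩
  · rintro i j y y' ⟨x, hx, h⟩ ⟨x', hx', h'⟩
    rw [← hA.rel_iff hx hx']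
    exact ⟨fun h1 => a.rel.trans' h (a.rel.trans' h1 (a.rel.symm' h')),
      fun h1 => a.rel.trans' (a.rel.symm' h) (a.rel.trans' h1 h')⟩
  · intro x y
    constructor
    · intro h
      obtain ⟨i, hi⟩ := (hdom x).1 (mem_dom.2 ⟨y, h⟩)
      exact ⟨i, hi, x, hi, h⟩
    · rintro ⟨i, hi, x', hx', h⟩
      exact a.rel.trans' ((hA.rel_iff hi hx').2 rfl) h

/-- The families attached to the lower parts of transversal blocks. -/
theorem exists_presents_lower (hB : ClassFamily a.coker B)
    (hcodom : ∀ y, y ∈ a.codom ↔ ∃ i, y ∈ B i) :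
    ∃ A : ι → Set (Fin n), ClassFamily a.ker A ∧ Presents a a.ker a.coker A B := by
  refine ⟨fun i => {x | ∃ y ∈ B i, a.rel (Sum.inl x) (Sum.inr y)}, ⟨?_, ?_, ?_⟩,
    Iff.rfl, Iff.rfl, ?_⟩
  · intro i
    obtain ⟨y, hy⟩ := hB.nonempty i
    obtain ⟨x, hx⟩ := mem_codom.1 ((hcodom y).2 ⟨i, hy⟩)
    exact ⟨x, y, hy, hx⟩
  · rintro i x x' ⟨y, hy, h⟩ h'
    exact ⟨y, hy, a.rel.trans' (a.rel.symm' h') h⟩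
  · rintro i j x x' ⟨y, hy, h⟩ ⟨y', hy', h'⟩
    rw [← hB.rel_iff hy hy']
    exact ⟨fun h1 => a.rel.trans' (a.rel.symm' h) (a.rel.trans' h1 h'),
      fun h1 => a.rel.trans' h (a.rel.trans' h1 (a.rel.symm' h'))⟩
  · intro x y
    constructor
    · intro h
      obtain ⟨i, hi⟩ := (hcodom y).1 (mem_codom.2 ⟨x, h⟩)
      exact ⟨i, ⟨y, hi, h⟩, hi⟩
    · rintro ⟨i, ⟨y', hy', h⟩, hi⟩
      exact a.rel.trans' h ((hB.rel_iff hy' hi).2 rfl)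

theorem mem_classes_iff {s : Set (Fin n)} :
    s ∈ K.classes ↔ s.Nonempty ∧ ∀ x ∈ s, ∀ y, y ∈ s ↔ K x y := by
  constructor
  · rintro ⟨p, rfl⟩
    exact ⟨⟨p, K.refl' p⟩, fun x hx y =>
      ⟨fun hy => K.trans' hx (K.symm' hy), fun hy => K.trans' (K.symm' hy) hx⟩⟩
  · rintro ⟨⟨p, hp⟩, h⟩
    exact ⟨p, Set.ext fun y => (h p hp y).trans ⟨K.symm', K.symm'⟩⟩

theorem ClassFamily.mem_classes (hA : ClassFamily K A) (i : ι) : A i ∈ K.classes :=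
  mem_classes_iff.2 ⟨hA.nonempty i, fun _ hx _ =>
    ⟨fun hy => (hA.rel_iff hx hy).2 rfl, fun hy => hA.mem_of_rel hx hy⟩⟩

/-- Every partition is presented by the families of the upper and lower parts of its transversal
blocks. -/
theorem exists_presents_fin (a : PartitionMonoid n) :
    ∃ (m : ℕ) (A B : Fin m → Set (Fin n)), ClassFamily a.ker A ∧ ClassFamily a.coker B ∧
      Presents a a.ker a.coker A B := by
  obtain ⟨m, ⟨f⟩⟩ := Finite.exists_equiv_fin a.kerT
  have hA : ClassFamily a.ker (fun i => (f.symm i : Set (Fin n))) := by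
    have h := fun i => mem_classes_iff.1 (f.symm i).2.1
    refine ⟨fun i => (h i).1, fun {i x y} hx => ((h i).2 x hx y).2, fun {i j x y} hx hy => ?_⟩
    rw [← (h i).2 x hx y]
    constructor
    · intro hy'
      refine f.symm.injective (Subtype.ext (Set.ext fun z => ?_))
      rw [(h i).2 y hy', (h j).2 y hy]
    · rintro rfl
      exact hy
  obtain ⟨B, hB, h⟩ := exists_presents_upper hA fun x => by
    constructor
    · intro hx
      have hT : {y | a.ker y x} ∈ a.kerT := by
        refine ⟨Setoid.mem_classes _ _, fun y hy => ?_⟩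
        obtain ⟨z, hz⟩ := mem_dom.1 hx
        exact mem_dom.2 ⟨z, a.rel.trans' hy hz⟩
      exact ⟨f ⟨_, hT⟩, by rw [f.symm_apply_apply]; exact a.ker.refl' x⟩
    · rintro ⟨i, hi⟩
      exact (f.symm i).2.2 hi
  exact ⟨m, _, B, hA, hB, h⟩

theorem ClassFamily.exists_perm [Finite ι] (hB : ClassFamily L B) (hB' : ClassFamily L B')
    (h : ∀ y, (∃ i, y ∈ B i) ↔ ∃ i, y ∈ B' i) : ∃ τ : Equiv.Perm ι, B' = B ∘ τ := by
  have key : ∀ i, ∃ j, B' i = B j := by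
    intro i
    obtain ⟨y, hy⟩ := hB'.nonempty i
    obtain ⟨j, hj⟩ := (h y).2 ⟨i, hy⟩
    refine ⟨j, Set.ext fun z => ?_⟩
    rw [(mem_classes_iff.1 (hB'.mem_classes i)).2 y hy,
      (mem_classes_iff.1 (hB.mem_classes j)).2 y hj]
  choose f hf using key
  have hinj : f.Injective := by
    intro i j hij
    obtain ⟨y, hy⟩ := hB'.nonempty i
    exact hB'.eq_index hy (by rw [hf j, ← hij, ← hf i]; exact hy)
  exact ⟨Equiv.ofBijective f (Finite.injective_iff_bijective.1 hinj), funext hf⟩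

/-! ### Cycle types of group elements -/

theorem _root_.InMaximalSubgroup.ker_eq (h : InMaximalSubgroup e a) : a.ker = e.ker := by
  obtain ⟨-, h1, -, x, -, -, h5, -⟩ := h
  exact ker_eq_of_mul h1 h5

theorem _root_.InMaximalSubgroup.coker_eq (h : InMaximalSubgroup e a) : a.coker = e.coker := by
  obtain ⟨-, -, h2, x, -, -, -, h6⟩ := h
  exact coker_eq_of_mul h2 h6

theorem _root_.InMaximalSubgroup.dom_eq (h : InMaximalSubgroup e a) : a.dom = e.dom := by
  obtain ⟨-, h1, -, x, -, -, h5, -⟩ := h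
  exact dom_eq_of_mul h1 h5

theorem _root_.InMaximalSubgroup.codom_eq (h : InMaximalSubgroup e a) : a.codom = e.codom := by
  obtain ⟨-, -, h2, x, -, -, -, h6⟩ := h
  exact codom_eq_of_mul h2 h6

/-- Group elements at `e` have the same upper parts and the same lower parts of transversal blocks
as `e`; only the matching between them is free. -/
theorem _root_.InMaximalSubgroup.exists_perm [Finite ι] (h : InMaximalSubgroup e a)
    (he : Presents e K L A B) (hA : ClassFamily K A) (hB : ClassFamily L B) :
    ∃ τ : Equiv.Perm ι, Presents a K L A (B ∘ τ) := by
  obtain rfl := he.ker_eq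
  obtain rfl := he.coker_eq
  rw [← h.ker_eq] at hA
  obtain ⟨B', hB', h'⟩ := exists_presents_upper hA fun x => by
    rw [h.dom_eq, he.mem_dom_iff hB]
  obtain ⟨τ, rfl⟩ := hB.exists_perm (h.coker_eq ▸ hB') fun y => by
    rw [← he.mem_codom_iff (h.ker_eq ▸ hA), ← h.codom_eq, h'.mem_codom_iff hA]
  rw [h.ker_eq, h.coker_eq] at h'
  exact ⟨τ, h'⟩

theorem Presents.isTransversal_iff (ha : Presents a K L A B) (hA : ClassFamily K A)
    (hB : ClassFamily L B) {i j : ι} :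
    a.IsTransversal (Sum.inl '' A i ∪ Sum.inr '' B j) ↔ i = j := by
  constructor
  · rintro ⟨⟨p, hp⟩, -, -⟩
    obtain ⟨x, hx⟩ := hA.nonempty i
    obtain ⟨y, hy⟩ := hB.nonempty j
    have h1 : a.rel (Sum.inl x) p := by
      have : (Sum.inl x : Fin n ⊕ Fin n) ∈ {q | a.rel q p} := hp ▸ Or.inl ⟨x, hx, rfl⟩
      exact this
    have h2 : a.rel (Sum.inr y) p := by
      have : (Sum.inr y : Fin n ⊕ Fin n) ∈ {q | a.rel q p} := hp ▸ Or.inr ⟨y, hy, rfl⟩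
      exact this
    obtain ⟨k, hk, hk'⟩ := ha.cross.1 (a.rel.trans' h1 (a.rel.symm' h2))
    exact (hA.eq_index hx hk).trans (hB.eq_index hk' hy)
  · rintro rfl
    obtain ⟨x, hx⟩ := hA.nonempty i
    obtain ⟨y, hy⟩ := hB.nonempty i
    refine ⟨⟨Sum.inl x, ?_⟩, ⟨x, Or.inl ⟨x, hx, rfl⟩⟩, y, Or.inr ⟨y, hy, rfl⟩⟩
    ext (z | z)
    · simp only [Set.mem_union, Set.mem_image, Sum.inl.injEq, exists_eq_right, reduceCtorEq,
        and_false, exists_false, or_false, Set.mem_ofPred_eq, ha.upper]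
      exact ⟨fun hz => (hA.rel_iff hz hx).2 rfl, fun hz => hA.mem_of_rel hx (K.symm' hz)⟩
    · simp only [Set.mem_union, Set.mem_image, Sum.inr.injEq, exists_eq_right, reduceCtorEq,
        and_false, exists_false, false_or, Set.mem_ofPred_eq]
      refine ⟨fun hz => a.rel.symm' (ha.cross.2 ⟨i, hx, hz⟩), fun hz => ?_⟩
      obtain ⟨k, hk, hk'⟩ := ha.cross.1 (a.rel.symm' hz)
      obtain rfl := hA.eq_index hx hk
      exact hk'

theorem isTransversal_nonempty_inter {P : Set (Fin n)} :
    (∃ s, a.IsTransversal s ∧ ((Sum.inl '' P) ∩ s).Nonempty) ↔ ∃ x ∈ P, x ∈ a.dom := by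
  constructor
  · rintro ⟨s, hs, _, ⟨x, hx, rfl⟩, hxs⟩
    exact ⟨x, hx, s, hs, hxs⟩
  · rintro ⟨x, hx, s, hs, hxs⟩
    exact ⟨s, hs, _, ⟨x, hx, rfl⟩, hxs⟩

/-- The permutation of the transversal blocks determines the cycle type. -/
theorem hasCycleType_of_presents {m : ℕ} {A B : Fin m → Set (Fin n)} {τ : Equiv.Perm (Fin m)}
    (hg : IsGroupElement a) (ha : Presents a K L A (B ∘ τ)) (hA : ClassFamily K A)
    (hB : ClassFamily L B) (h : Linked (K ⊔ L) B A) : a.HasCycleType (permCycleType τ) := by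
  have hBτ : ClassFamily L (B ∘ τ) := hB.comp τ.injective
  have hdom := fun x => ha.mem_dom_iff hBτ (x := x)
  have hcodom := fun y => ha.mem_codom_iff hA (y := y)
  -- The join class around `A i`; linkedness puts `B i` into it and keeps parts of other indices
  -- out.
  let P : Fin m → Set (Fin n) := fun i => {x | ∃ y ∈ A i, (K ⊔ L) x y}
  have hP : ∀ i, ∀ x ∈ A i, P i = {z | (K ⊔ L) z x} := by
    intro i x hx
    refine Set.ext fun z => ⟨?_, fun hz => ⟨x, hx, hz⟩⟩
    rintro ⟨y, hy, hz⟩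
    exact Setoid.trans' _ hz (le_sup_left_apply ((hA.rel_iff hy hx).2 rfl))
  refine ⟨hg, m, P, A, B, τ, ?_, ?_, ?_, ?_, ?_, rfl⟩
  · intro i j hij
    obtain ⟨x, hx⟩ := hA.nonempty i
    obtain ⟨y, hy, hxy⟩ : x ∈ P j := hij ▸ ⟨x, hx, Setoid.refl' _ x⟩
    exact h.eq_right hB hx hy hxy
  · ext Q
    rw [activeBlocks, Set.mem_ofPred_eq, isTransversal_nonempty_inter, ha.ker_eq, ha.coker_eq]
    constructor
    · rintro ⟨i, rfl⟩
      obtain ⟨x, hx⟩ := hA.nonempty i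
      exact ⟨⟨x, hP i x hx⟩, x, ⟨x, hx, Setoid.refl' _ x⟩, (hdom x).2 ⟨i, hx⟩⟩
    · rintro ⟨hQ, x, hx, hxd⟩
      obtain ⟨i, hi⟩ := (hdom x).1 hxd
      refine ⟨i, (hP i x hi).trans (Set.ext fun z => ?_)⟩
      rw [(mem_classes_iff.1 hQ).2 x hx]
      exact ⟨fun h => Setoid.symm' _ h, fun h => Setoid.symm' _ h⟩
  · intro i
    exact ⟨⟨ha.ker_eq ▸ hA.mem_classes i, fun x hx => (hdom x).2 ⟨i, hx⟩⟩,
      fun x hx => ⟨x, hx, Setoid.refl' _ x⟩⟩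
  · intro i
    obtain ⟨x, hx⟩ := hA.nonempty i
    exact ⟨⟨ha.coker_eq ▸ hB.mem_classes i,
      fun y hy => (hcodom y).2 ⟨τ.symm i, by simpa using hy⟩⟩,
      fun y hy => ⟨x, hx, (h hy hx).2 rfl⟩⟩
  · intro i j
    -- The lower family is `B ∘ τ`, so `B j` has index `τ.symm j` in it.
    have := ha.isTransversal_iff hA hBτ (i := i) (j := τ.symm j)
    rw [Function.comp_apply, Equiv.apply_symm_apply] at this
    rw [this, Equiv.eq_symm_apply]

/-- Any choice of `P`, `A`, `B` in the definition of the cycle type is an enumeration of the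
transversal blocks of `e`. It is compared with a fixed enumeration `C`, `D`: lying in a common `P
i`, the sets `A i` and `B i` have the same index there, and since `P` lists the active blocks
without repetition, this index map is bijective. -/
theorem HasCycleType.exists_presents {l : List ℕ} (h : a.HasCycleType l)
    (he : InMaximalSubgroup e a) :
    ∃ (m : ℕ) (A B : Fin m → Set (Fin n)) (τ : Equiv.Perm (Fin m)), l = permCycleType τ ∧
      ClassFamily e.ker A ∧ ClassFamily e.coker B ∧ Linked (e.ker ⊔ e.coker) B A ∧
      Presents e e.ker e.coker A B ∧ Presents a e.ker e.coker A (B ∘ τ) := by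
  obtain ⟨-, m, P, A, B, τ, hPinj, hPrange, hA, hB, hτ, rfl⟩ := h
  obtain ⟨k, C, D, hC, hD, hCD⟩ := exists_presents_fin e
  have hlink := hCD.linked hC hD he.1
  have hdom := fun x => hCD.mem_dom_iff hD (x := x)
  have hcodom := fun x => hCD.mem_codom_iff hC (y := x)
  have hactive : ∀ i, P i ∈ (e.ker ⊔ e.coker).classes := fun i => by
    have : P i ∈ a.activeBlocks := hPrange ▸ ⟨i, rfl⟩
    rw [← he.ker_eq, ← he.coker_eq]
    exact this.1
  have hrel : ∀ i, ∀ x ∈ P i, ∀ y ∈ P i, (e.ker ⊔ e.coker) x y := fun i x hx y hy =>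
    ((mem_classes_iff.1 (hactive i)).2 x hx y).1 hy
  have hAC : ∀ i, ∃ j, A i = C j := by
    intro i
    have h1 := (hA i).1.1
    rw [he.ker_eq] at h1
    obtain ⟨⟨x, hx⟩, h2⟩ := mem_classes_iff.1 h1
    obtain ⟨j, hj⟩ := (hdom x).1 (he.dom_eq ▸ (hA i).1.2 hx)
    refine ⟨j, Set.ext fun z => ?_⟩
    rw [h2 x hx, (mem_classes_iff.1 (hC.mem_classes j)).2 x hj]
  have hBD : ∀ i, ∃ j, B i = D j := by
    intro i
    have h1 := (hB i).1.1
    rw [he.coker_eq] at h1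
    obtain ⟨⟨x, hx⟩, h2⟩ := mem_classes_iff.1 h1
    obtain ⟨j, hj⟩ := (hcodom x).1 (he.codom_eq ▸ (hB i).1.2 hx)
    refine ⟨j, Set.ext fun z => ?_⟩
    rw [h2 x hx, (mem_classes_iff.1 (hD.mem_classes j)).2 x hj]
  choose f hf using hAC
  obtain rfl : A = C ∘ f := funext hf
  choose g hg using hBD
  obtain rfl : g = f := funext fun i => by
    obtain ⟨x, hx⟩ := hC.nonempty (f i)
    obtain ⟨y, hy⟩ := hD.nonempty (g i)
    exact (hlink hy hx).1 (hrel i y ((hB i).2 (hg i ▸ hy)) x ((hA i).2 hx))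
  obtain rfl : B = D ∘ g := funext hg
  have hinj : g.Injective := by
    intro i j hij
    obtain ⟨x, hx⟩ := hC.nonempty (g i)
    have h1 : x ∈ P i := (hA i).2 hx
    have h2 : x ∈ P j := (hA j).2 (show x ∈ C (g j) from hij ▸ hx)
    refine hPinj (Set.ext fun z => ?_)
    rw [(mem_classes_iff.1 (hactive i)).2 x h1, (mem_classes_iff.1 (hactive j)).2 x h2]
  have hsurj : g.Surjective := by
    intro k
    obtain ⟨x, hx⟩ := hC.nonempty k
    have : {z | (a.ker ⊔ a.coker) z x} ∈ a.activeBlocks :=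
      ⟨Setoid.mem_classes _ _, isTransversal_nonempty_inter.2
        ⟨x, (a.ker ⊔ a.coker).refl' x, by rw [he.dom_eq]; exact (hdom x).2 ⟨k, hx⟩⟩⟩
    rw [← hPrange] at this
    obtain ⟨i, hi⟩ := this
    obtain ⟨y, hy⟩ := hC.nonempty (g i)
    have hxi : x ∈ P i := by
      rw [hi]
      exact (a.ker ⊔ a.coker).refl' x
    exact ⟨i, hlink.eq_right hD hy hx (hrel i y ((hA i).2 hy) x hxi)⟩
  have hA' : ClassFamily e.ker (C ∘ g) := hC.comp hinj
  have hB' : ClassFamily e.coker (D ∘ g) := hD.comp hinj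
  have he' : Presents e e.ker e.coker (C ∘ g) (D ∘ g) := hCD.comp hsurj
  obtain ⟨σ, hσ⟩ := he.exists_perm he' hA' hB'
  obtain rfl : σ = τ := Equiv.ext fun i => by
    refine ((hτ i (σ i)).2 ?_).symm
    exact (hσ.isTransversal_iff hA' (hB'.comp σ.injective) (i := i) (j := i)).2 rfl
  exact ⟨m, _, _, σ, rfl, hA', hB', hlink.comp hinj, he', hσ⟩

/-! ### Trace conjugacy and cycle types -/

theorem sameCycleType_of_traceConj (hab : TraceConj a b) :
    SameCycleType (omegaSuccPow a) (omegaSuccPow b) := by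
  obtain ⟨g, h, hghg, hhgh, hgh, hhg, hconj⟩ := hab
  have ha := omegaSuccPow_spec a
  have hb := omegaSuccPow_spec b
  generalize omegaSuccPow a = a' at *
  generalize omegaSuccPow b = b' at *
  generalize omegaPow a = e at *
  generalize omegaPow b = f at *
  have heg : e * g = g := by rw [← hgh, hghg]
  have hhe : h * e = h := by rw [← hgh, ← mul_assoc, hhgh]
  obtain ⟨m, A, B, hA, hB, he⟩ := exists_presents_fin e
  have hlink := he.linked hA hB ha.1
  obtain ⟨τ, hτ⟩ := ha.exists_perm he hA hB
  have hgk : g.ker = e.ker := ker_eq_of_mul heg hgh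
  have hhk : h.coker = e.coker := coker_eq_of_mul hhe hgh
  have hgd : g.dom = e.dom := dom_eq_of_mul heg hgh
  have hhd : h.codom = e.codom := codom_eq_of_mul hhe hgh
  obtain ⟨B', hB', hg⟩ := exists_presents_upper (hgk ▸ hA) fun x => by
    rw [hgd, he.mem_dom_iff hB]
  obtain ⟨A', hA', hh⟩ := exists_presents_lower (hhk ▸ hB) fun x => by
    rw [hhd, he.mem_codom_iff hA]
  rw [hgk] at hg
  rw [hhk] at hh
  have hlink' : Linked (e.coker ⊔ e.ker) B A := sup_comm e.ker e.coker ▸ hlink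
  have hf : Presents f h.ker g.coker A' B' := hhg ▸ hh.mul hg hA' hB hA hB' hlink'
  have hha : Presents (h * a') h.ker e.coker A' (B ∘ τ) :=
    hh.mul hτ hA' hB hA (hB.comp τ.injective) hlink'
  -- `g` is reindexed along `τ` so that its upper family `A ∘ τ` is linked to the lower family `B ∘
  -- τ` of `h * a'`.
  have hhag : Presents b' h.ker g.coker A' (B' ∘ τ) :=
    hconj ▸ hha.mul (hg.comp τ.surjective) hA' (hB.comp τ.injective) (hA.comp τ.injective)
      (hB'.comp τ.injective) (hlink'.comp τ.injective)
  exact ⟨_, hasCycleType_of_presents ⟨e, ha⟩ hτ hA hB hlink,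
    hasCycleType_of_presents ⟨f, hb⟩ hhag hA' hB' (hf.linked hA' hB' hb.1)⟩

/-- If the blocks of two partitions have admissible sizes, then so have the blocks of the
partition with the upper blocks of the first one and the lower blocks of the second one. -/
theorem Presents.block_size {p : ℕ → Prop} (hp : ∀ k, p k → k ≤ 2) (hp2 : p 2)
    (ha : Presents a K L A B) (hb : Presents b K' L' A' B') (hc : Presents c K L' A B')
    (hA : ClassFamily K A) (hB : ClassFamily L B) (hA' : ClassFamily K' A')
    (hB' : ClassFamily L' B') (hpa : ∀ s ∈ a.blocks, p s.ncard)
    (hpb : ∀ s ∈ b.blocks, p s.ncard) : ∀ s ∈ c.blocks, p s.ncard := by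
  have key : ∀ {a : PartitionMonoid n} {K L : Setoid (Fin n)} {A B : ι → Set (Fin n)},
      Presents a K L A B → ClassFamily K A → ClassFamily L B → (∀ s ∈ a.blocks, p s.ncard) →
      ∀ i, (A i).ncard = 1 ∧ (B i).ncard = 1 := by
    intro a K L A B ha hA hB hpa i
    -- A transversal block has at most two points and both of its parts are nonempty, so each part
    -- is a single point.
    have h1 := hp _ (hpa _ ((ha.isTransversal_iff hA hB (i := i) (j := i)).2 rfl).1)
    rw [Set.ncard_union_eq (by
      rw [Set.disjoint_left]
      rintro _ ⟨x, -, rfl⟩ ⟨y, -, h⟩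
      cases h), Set.ncard_image_of_injective _ Sum.inl_injective,
      Set.ncard_image_of_injective _ Sum.inr_injective] at h1
    have h2 := (hA.nonempty i).ncard_pos
    have h3 := (hB.nonempty i).ncard_pos
    omega
  have htrans : ∀ i, p (Sum.inl '' A i ∪ Sum.inr '' B' i : Set (Fin n ⊕ Fin n)).ncard := by
    intro i
    rw [Set.ncard_union_eq (by
      rw [Set.disjoint_left]
      rintro _ ⟨x, -, rfl⟩ ⟨y, -, h⟩
      cases h), Set.ncard_image_of_injective _ Sum.inl_injective,
      Set.ncard_image_of_injective _ Sum.inr_injective, (key ha hA hB hpa i).1,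
      (key hb hA' hB' hpb i).2]
    exact hp2
  have hblock : ∀ i, ∀ q, q ∈ (Sum.inl '' A i ∪ Sum.inr '' B' i : Set (Fin n ⊕ Fin n)) →
      {r | c.rel r q} = Sum.inl '' A i ∪ Sum.inr '' B' i := by
    intro i q hq
    obtain ⟨r, hr⟩ := ((hc.isTransversal_iff hA hB' (i := i) (j := i)).2 rfl).1
    rw [hr] at hq ⊢
    exact Set.ext fun z => ⟨fun hz => c.rel.trans' hz hq,
      fun hz => c.rel.trans' hz (c.rel.symm' hq)⟩
  rintro s ⟨q | q, rfl⟩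
  · by_cases hq : ∃ i, q ∈ A i
    · obtain ⟨i, hi⟩ := hq
      rw [hblock i _ (Or.inl ⟨q, hi, rfl⟩)]
      exact htrans i
    -- Outside the transversal blocks, an upper block of `c` is an upper block of `a`; likewise
    -- below for lower blocks and `b`.
    · convert hpa _ (Setoid.mem_classes a.rel (Sum.inl q)) using 3
      ext (z | z)
      · exact hc.upper.trans ha.upper.symm
      · exact ⟨fun h => absurd ((hc.cross.1 (c.rel.symm' h)).imp fun _ => And.left) hq,
          fun h => absurd ((ha.cross.1 (a.rel.symm' h)).imp fun _ => And.left) hq⟩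
  · by_cases hq : ∃ i, q ∈ B' i
    · obtain ⟨i, hi⟩ := hq
      rw [hblock i _ (Or.inr ⟨q, hi, rfl⟩)]
      exact htrans i
    · convert hpb _ (Setoid.mem_classes b.rel (Sum.inr q)) using 3
      ext (z | z)
      · exact ⟨fun h => absurd ((hc.cross.1 h).imp fun _ => And.right) hq,
          fun h => absurd ((hb.cross.1 h).imp fun _ => And.right) hq⟩
      · exact hc.lower.trans hb.lower.symm

/-- A submonoid that contains all partitions with the upper blocks of one of its elements and the
lower blocks of another one of the same rank. -/
def IsBlockClosed (S : Submonoid (PartitionMonoid n)) : Prop :=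
  ∀ ⦃m : ℕ⦄ ⦃a b c : PartitionMonoid n⦄ ⦃K L K' L' : Setoid (Fin n)⦄
    ⦃A B A' B' : Fin m → Set (Fin n)⦄, Presents a K L A B → Presents b K' L' A' B' →
    Presents c K L' A B' → ClassFamily K A → ClassFamily L B → ClassFamily K' A' →
    ClassFamily L' B' → a ∈ S → b ∈ S → c ∈ S

theorem isBlockClosed_partialBrauerMonoid : IsBlockClosed (partialBrauerMonoid n) :=
  fun _ _ _ _ _ _ _ _ _ _ _ _ ha hb hc hA hB hA' hB' =>
    ha.block_size (p := (· ≤ 2)) (fun _ => id) le_rfl hb hc hA hB hA' hB'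

theorem isBlockClosed_brauerMonoid : IsBlockClosed (brauerMonoid n) :=
  fun _ _ _ _ _ _ _ _ _ _ _ _ ha hb hc hA hB hA' hB' =>
    ha.block_size (p := (· = 2)) (fun _ => le_of_eq) rfl hb hc hA hB hA' hB'

/-- The elements `g` and `h` are built from the blocks of the two idempotents alone. The last clause
records this for any block-closed submonoid, so that one construction serves all three monoids. -/
theorem exists_conj_of_sameCycleType (h : SameCycleType (omegaSuccPow a) (omegaSuccPow b)) :
    ∃ g h : PartitionMonoid n, g * h * g = g ∧ h * g * h = h ∧ g * h = omegaPow a ∧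
      h * g = omegaPow b ∧ h * omegaSuccPow a * g = omegaSuccPow b ∧
      ∀ S : Submonoid (PartitionMonoid n), IsBlockClosed S → omegaPow a ∈ S → omegaPow b ∈ S →
        g ∈ S ∧ h ∈ S := by
  obtain ⟨l, hla, hlb⟩ := h
  obtain ⟨m, A, B, τ, hl, hA, hB, hlink, he, ha⟩ := hla.exists_presents (omegaSuccPow_spec a)
  obtain ⟨m', A', B', τ', rfl, hA', hB', hlink', hf, hb⟩ :=
    hlb.exists_presents (omegaSuccPow_spec b)
  obtain rfl := eq_of_permCycleType_eq hl
  obtain ⟨π, hπ⟩ := isConj_iff.1 (isConj_of_permCycleType_eq hl.symm)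
  generalize omegaSuccPow a = a' at *
  generalize omegaSuccPow b = b' at *
  generalize omegaPow a = e at *
  generalize omegaPow b = f at *
  -- From `π * τ * π⁻¹ = τ'`, reindexing the families of `b'` by `π` turns its permutation `τ'` into
  -- `τ`.
  replace hb : Presents b' f.ker f.coker (A' ∘ π) ((B' ∘ π) ∘ τ) := by
    have hcomm : (B' ∘ τ') ∘ π = (B' ∘ π) ∘ τ := by
      funext i
      simp [← hπ]
    exact hcomm ▸ hb.comp π.surjective
  replace hA' := hA'.comp π.injective
  replace hB' := hB'.comp π.injective
  replace hlink' := hlink'.comp π.injective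
  replace hf := hf.comp π.surjective
  generalize A' ∘ π = A' at *
  generalize B' ∘ π = B' at *
  rw [sup_comm] at hlink hlink'
  obtain ⟨g, hg⟩ := PartitionMonoid.exists_presents hA hB'
  obtain ⟨h, hh⟩ := PartitionMonoid.exists_presents hA' hB
  have hgh := hg.mul hh hA hB' hA' hB hlink'
  have hhg := hh.mul hg hA' hB hA hB' hlink
  have hha := hh.mul ha hA' hB hA (hB.comp τ.injective) hlink
  have hhag := hha.mul (hg.comp τ.surjective) hA' (hB.comp τ.injective) (hA.comp τ.injective)
    (hB'.comp τ.injective) (hlink.comp τ.injective)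
  exact ⟨g, h, (hgh.mul hg hA hB hA hB' hlink).eq hg, (hhg.mul hh hA' hB' hA' hB hlink').eq hh,
    hgh.eq he, hhg.eq hf, hhag.eq hb, fun S hS heS hfS =>
      ⟨hS he hf hg hA hB hA' hB' heS hfS, hS hf he hh hA' hB' hA hB hfS heS⟩⟩

/-- The inclusion of `S` preserves trace conjugacy. Conversely, the conjugators found in the full
monoid lie in `S`, because `S` is block-closed and contains both idempotents. -/
theorem traceConj_iff_sameCycleType {S : Submonoid (PartitionMonoid n)} (hS : IsBlockClosed S)
    (a b : S) : TraceConj a b ↔ SameCycleType ((omegaSuccPow a : S) : PartitionMonoid n)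
      ((omegaSuccPow b : S) : PartitionMonoid n) := by
  have hω : ∀ c : S, ((omegaPow c : S) : PartitionMonoid n) = omegaPow (c : PartitionMonoid n) :=
    map_omegaPow S.subtype
  have hω' : ∀ c : S, ((omegaSuccPow c : S) : PartitionMonoid n) =
      omegaSuccPow (c : PartitionMonoid n) := map_omegaSuccPow S.subtype
  rw [hω', hω']
  refine ⟨fun h => sameCycleType_of_traceConj (h.map S.subtype), fun h => ?_⟩
  obtain ⟨g, h, h1, h2, h3, h4, h5, h6⟩ := exists_conj_of_sameCycleType h
  obtain ⟨hg, hh⟩ := h6 S hS (hω a ▸ (omegaPow a).2) (hω b ▸ (omegaPow b).2)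
  exact ⟨⟨g, hg⟩, ⟨h, hh⟩, Subtype.ext h1, Subtype.ext h2, Subtype.ext (h3.trans (hω a).symm),
    Subtype.ext (h4.trans (hω b).symm),
    Subtype.ext (by simp only [Submonoid.coe_mul, hω', h5])⟩

theorem traceConj_iff (a b : PartitionMonoid n) :
    TraceConj a b ↔ SameCycleType (omegaSuccPow a) (omegaSuccPow b) := by
  refine ⟨sameCycleType_of_traceConj, fun h => ?_⟩
  obtain ⟨g, h, h1, h2, h3, h4, h5, -⟩ := exists_conj_of_sameCycleType h
  exact ⟨g, h, h1, h2, h3, h4, h5⟩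

end PartitionMonoid

theorem mainTheorem5 (n : ℕ) :
    (∀ a b : PartitionMonoid n,
      TraceConj a b ↔ PartitionMonoid.SameCycleType (omegaSuccPow a) (omegaSuccPow b)) ∧
    (∀ a b : partialBrauerMonoid n,
      TraceConj a b ↔ PartitionMonoid.SameCycleType
        ((omegaSuccPow a : partialBrauerMonoid n) : PartitionMonoid n) ((omegaSuccPow b : partialBrauerMonoid n) : PartitionMonoid n)) ∧
    (∀ a b : brauerMonoid n,
      TraceConj a b ↔ PartitionMonoid.SameCycleType
        ((omegaSuccPow a : brauerMonoid n) : PartitionMonoid n) ((omegaSuccPow b : brauerMonoid n) : PartitionMonoid n)) :=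
  ⟨PartitionMonoid.traceConj_iff,
    PartitionMonoid.traceConj_iff_sameCycleType
      PartitionMonoid.isBlockClosed_partialBrauerMonoid,
    PartitionMonoid.traceConj_iff_sameCycleType PartitionMonoid.isBlockClosed_brauerMonoid⟩
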